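/- Let $D$ be a connected (finite-dimensional, real) Lie group, let $\mathfrak d=T_1D$ be its Lie algebra with the bracket defined by right-invariant vector fields, and suppose that $\dim\mathfrak d=2n$ and that $\mathfrak d$ carries an $\mathrm{Ad}$-invariant nondegenerate symmetric bilinear form $\langle\cdot,\cdot\rangle_{\mathfrak d}$ of signature $(n,n)$. Let $G\subset D$ be a connected closed subgroup whose Lie algebra $\mathfrak g\subset\mathfrak d$ is a maximal isotropic subspace. Let $S=D/G$ (the quotient by right multiplication) carry its quotient manifold structure, i.e. the one for which $p:D\to S$ is a smooth submersion, and let $D$ act on $S$ by left multiplication (the dressing action). Write $\rho_S:\mathfrak d\to\mathfrak X(S)$, $\rho_S(u)_x=\frac{d}{dt}\big|_{t=0}\exp(tu)\cdot x$, for the infinitesimal action, and $\rho=\rho_S|_{\mathfrak g}$. Let $s\in\Omega^1(S,\mathfrak d)$ be a connection splitting: $\rho_S(s(X))=X$ and $\langle s(X),s(Y)\rangle_{\mathfrak d}=0$ for all $x\in S$ and $X,Y\in T_xS$. Put $$\phi_S=\tfrac12\langle ds,s\rangle_{\mathfrak d}+\tfrac16\langle[s,s]_{\mathfrak d},s\rangle_{\mathfrak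 d}\in\Omega^3(S),\qquad \sigma(v)(X)=\langle s(X),v\rangle_{\mathfrak d}\quad(v\in\mathfrak g),$$ where the products of vector-valued forms are wedge products, normalized so that $[s,s]_{\mathfrak d}(X,Y)=2[s(X),s(Y)]_{\mathfrak d}$ and $\langle[s,s]_{\mathfrak d},s\rangle_{\mathfrak d}(X,Y,Z)=6\langle[s(X),s(Y)]_{\mathfrak d},s(Z)\rangle_{\mathfrak d}$. Suppose that $s$ is $G$-equivariant, i.e. $s(g_*X)=\mathrm{Ad}_g(s(X))$ for all $g\in G$ and $X\in TS$. Then $\sigma+\phi_S$, that is, $v\mapsto\sigma(v)+\phi_S$, is an equivariantly closed 3-form on $S$ for the dressing action of $G$: it is an element of degree $3$ of the Cartan complex $$\Omega^k_G(S)=\Big(\bigoplus_{2i+j=k}S^i(\mathfrak g^*)\otimes\Omega^j(S)\Big)^G,\qquad (d_GP)(v)=d(P(v))-i_{\rho(v)}(P(v)),$$ and $d_G(\sigma+\phi_S)=0$. (In particular $\sigma$ and $\phi_S$ are $G$-invariant, $d\phi_S=0$, $d\sigma(v)=i_{\rho(v)}\phi_S$ and $i_{\rho(v)}\sigma(v)=0$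 for all $v\in\mathfrak g$.) -/

import Mathlib

open scoped Manifold ContDiff Topology

noncomputable section

namespace GroupPair

/-! ### Differential forms on a manifold `S` modelled on `F` -/

section Forms

variable {F : Type*} [NormedAddCommGroup F] [NormedSpace ℝ F]
  {S : Type*} [TopologicalSpace S] [ChartedSpace F S]
  {V : Type*} [NormedAddCommGroup V] [NormedSpace ℝ V]
  {W : Type*} [NormedAddCommGroup W] [NormedSpace ℝ W]
  {U : Type*} [NormedAddCommGroup U] [NormedSpace ℝ U]

/-- Fields of `V`-valued alternating `k`-forms on the tangent spaces of `S` (no regularity). The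
differential forms `Ω^k(S, V)` are the fields that satisfy `IsSmoothForm`. -/
abbrev FormField (F : Type*) [NormedAddCommGroup F] [NormedSpace ℝ F]
    (S : Type*) [TopologicalSpace S] [ChartedSpace F S] (k : ℕ)
    (V : Type*) [NormedAddCommGroup V] [NormedSpace ℝ V] : Type _ :=
  ∀ x : S, TangentSpace 𝓘(ℝ, F) x [⋀^Fin k]→L[ℝ] V

/-- The expression of a form in the preferred chart at `x₀`: its pullback along the inverse of
the chart. -/
def inChart {k : ℕ} (η : FormField F S k V) (x₀ : S) (y : F) : F [⋀^Fin k]→L[ℝ] V :=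
  (η ((extChartAt 𝓘(ℝ, F) x₀).symm y)).compContinuousLinearMap
    (mfderiv 𝓘(ℝ, F) 𝓘(ℝ, F) (extChartAt 𝓘(ℝ, F) x₀).symm y)

/-- A form is smooth if its expressions in the charts are smooth. -/
def IsSmoothForm {k : ℕ} (η : FormField F S k V) : Prop :=
  ∀ x₀ : S, ContDiffOn ℝ ∞ (inChart η x₀) (extChartAt 𝓘(ℝ, F) x₀).target

/-- The exterior derivative: take the exterior derivative of the expression of the form in the
chart at `x`, and pull the result back along this chart. -/
def extD {k : ℕ} (η : FormField F S k V) : FormField F S (k + 1) V := fun x =>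
  (extDeriv (inChart η x) (extChartAt 𝓘(ℝ, F) x x)).compContinuousLinearMap
    (mfderiv 𝓘(ℝ, F) 𝓘(ℝ, F) (extChartAt 𝓘(ℝ, F) x) x)

/-- The pullback `f^* η`. -/
def pullback {k : ℕ} (f : S → S) (η : FormField F S k V) : FormField F S k V := fun x =>
  (η (f x)).compContinuousLinearMap (mfderiv 𝓘(ℝ, F) 𝓘(ℝ, F) f x)

/-- The contraction `i_X η = η(X, ·, …, ·)` with a vector field `X`. -/
def contract {k : ℕ} (X : ∀ x : S, TangentSpace 𝓘(ℝ, F) x) (η : FormField F S (k + 1) V) :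
    FormField F S k V := fun x =>
  { (η x).toAlternatingMap.curryLeft (X x) with
    cont := (η x).cont.comp (continuous_const.matrixVecCons continuous_id) }

theorem update_left_left {T : Type*} {k l : ℕ} (v : Fin (k + l) → T) (i : Fin k) (z : T) :
    (fun j => Function.update v (Fin.castAdd l i) z (Fin.castAdd l j)) =
      Function.update (fun j => v (Fin.castAdd l j)) i z := by
  funext j; by_cases hj : j = i <;> simp [hj]

theorem update_left_right {T : Type*} {k l : ℕ} (v : Fin (k + l) → T) (i : Fin k) (z : T) :
    (fun j => Function.update v (Fin.castAdd l i) z (Fin.natAdd k j)) =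
      fun j => v (Fin.natAdd k j) := by
  funext j; exact Function.update_of_ne (by simp [Fin.ext_iff]; omega) _ _

theorem update_right_left {T : Type*} {k l : ℕ} (v : Fin (k + l) → T) (i : Fin l) (z : T) :
    (fun j => Function.update v (Fin.natAdd k i) z (Fin.castAdd l j)) =
      fun j => v (Fin.castAdd l j) := by
  funext j; exact Function.update_of_ne (by simp [Fin.ext_iff]; omega) _ _

theorem update_right_right {T : Type*} {k l : ℕ} (v : Fin (k + l) → T) (i : Fin l) (z : T) :
    (fun j => Function.update v (Fin.natAdd k i) z (Fin.natAdd k j)) =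
      Function.update (fun j => v (Fin.natAdd k j)) i z := by
  funext j; by_cases hj : j = i <;> simp [hj]

/-- The product `(v₁, …, v_{k+l}) ↦ B(α(v₁, …, v_k), β(v_{k+1}, …, v_{k+l}))` of two alternating
maps along a bilinear map `B`. -/
def tensorMap {T : Type*} [AddCommGroup T] [Module ℝ T] [TopologicalSpace T]
    (B : V →L[ℝ] W →L[ℝ] U) {k l : ℕ} (α : T [⋀^Fin k]→L[ℝ] V) (β : T [⋀^Fin l]→L[ℝ] W) :
    ContinuousMultilinearMap ℝ (fun _ : Fin (k + l) => T) U where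
  toFun v := B (α fun i => v (Fin.castAdd l i)) (β fun j => v (Fin.natAdd k j))
  map_update_add' := by
    intro inst v i x y
    obtain rfl : inst = fun a b => instDecidableEqFin (k + l) a b := Subsingleton.elim _ _
    induction i using Fin.addCases with
    | left i => simp [update_left_left, update_left_right]
    | right i => simp [update_right_left, update_right_right]
  map_update_smul' := by
    intro inst v i c x
    obtain rfl : inst = fun a b => instDecidableEqFin (k + l) a b := Subsingleton.elim _ _
    induction i using Fin.addCases with
    | left i => simp [update_left_left, update_left_right]
    | right i => simp [update_right_left, update_right_right]
  cont := by
    have h1 : Continuous fun v : Fin (k + l) → T => α fun i => v (Fin.castAdd l i) :=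
      α.cont.comp (continuous_pi fun i => continuous_apply _)
    have h2 : Continuous fun v : Fin (k + l) → T => β fun j => v (Fin.natAdd k j) :=
      β.cont.comp (continuous_pi fun i => continuous_apply _)
    exact (B.continuous.comp h1).clm_apply h2

/-- The wedge product of vector-valued forms along a bilinear map `B`, normalized by
`B(α ∧ β)(v₁, …, v_{k+l}) =
  1/(k! l!) ∑_τ sign(τ) B(α(v_{τ 1}, …, v_{τ k}), β(v_{τ(k+1)}, …, v_{τ(k+l)}))`. -/
def wedge (B : V →L[ℝ] W →L[ℝ] U) {k l : ℕ} (α : FormField F S k V) (β : FormField F S l W) :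
    FormField F S (k + l) U := fun x =>
  ((k.factorial * l.factorial : ℝ)⁻¹) •
    ContinuousMultilinearMap.alternatization (tensorMap B (α x) (β x))

/-- A field of linear maps `T_x S → V`, seen as a form of degree one. -/
def oneForm (a : ∀ x : S, TangentSpace 𝓘(ℝ, F) x →L[ℝ] V) : FormField F S 1 V := fun x =>
  ContinuousAlternatingMap.ofSubsingleton ℝ (TangentSpace 𝓘(ℝ, F) x) V (0 : Fin 1) (a x)

end Forms

/-! ### The Lie algebra of `D`, with the bracket of right-invariant vector fields -/

section LieAlg

theorem mfderiv_congr_pt {E : Type*} [NormedAddCommGroup E] [NormedSpace ℝ E] {D : Type*}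
    [TopologicalSpace D] [ChartedSpace E D] (f : D → D) {a b : D} (h : a = b) (w : E) :
    (mfderiv 𝓘(ℝ, E) 𝓘(ℝ, E) f a w : E) = (mfderiv 𝓘(ℝ, E) 𝓘(ℝ, E) f b w : E) := by
  subst h; rfl

/-- The Lie algebra `𝔡 = T₁D` of `D`, as a normed space: a tangent space of `D` is a copy of the
model space `E`. -/
def LieAlg (E : Type*) [NormedAddCommGroup E] [NormedSpace ℝ E]
    (D : Type*) [TopologicalSpace D] [ChartedSpace E D] [Group D] : Type _ := E

variable {E : Type*} [NormedAddCommGroup E] [NormedSpace ℝ E]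
  {D : Type*} [TopologicalSpace D] [ChartedSpace E D] [Group D]

instance : NormedAddCommGroup (LieAlg E D) := inferInstanceAs (NormedAddCommGroup E)
instance : NormedSpace ℝ (LieAlg E D) := inferInstanceAs (NormedSpace ℝ E)
instance [FiniteDimensional ℝ E] : FiniteDimensional ℝ (LieAlg E D) :=
  inferInstanceAs (FiniteDimensional ℝ E)

/-- The tautological identification of `LieAlg E D` with the tangent space `T₁D`. -/
def toTangent : LieAlg E D ≃L[ℝ] TangentSpace 𝓘(ℝ, E) (1 : D) :=
  ContinuousLinearEquiv.refl ℝ E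

/-- The right-invariant vector field `u^r` on `D`, `u^r(a) = d(r_a)₁(u)`. -/
def rightField (u : LieAlg E D) (a : D) : TangentSpace 𝓘(ℝ, E) a :=
  (mfderiv 𝓘(ℝ, E) 𝓘(ℝ, E) (fun b : D => b * a) 1 (toTangent u) : E)

/-- The bracket `[u, v]_𝔡`: the value at `1` of the Lie bracket of the right-invariant vector
fields `u^r` and `v^r`. -/
def lieFun (u v : LieAlg E D) : LieAlg E D :=
  toTangent.symm (VectorField.mlieBracket 𝓘(ℝ, E) (rightField u) (rightField v) (1 : D))

theorem rightField_one (w : LieAlg E D) : rightField w (1 : D) = toTangent w := by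
  have h : (fun b : D => b * 1) = id := by ext; simp
  rw [rightField, h, mfderiv_id]; rfl

section
variable [LieGroup 𝓘(ℝ, E) ∞ D]

theorem mfderiv_inv_one (v : LieAlg E D) :
    (mfderiv 𝓘(ℝ, E) 𝓘(ℝ, E) (fun b : D => b⁻¹) 1 (toTangent v) : E) = -(toTangent v : E) := by
  have hinv : MDifferentiableAt 𝓘(ℝ, E) 𝓘(ℝ, E) (fun b : D => b⁻¹) 1 :=
    (contMDiff_inv 𝓘(ℝ, E) ∞).mdifferentiable (by simp) 1
  have hm : MDifferentiableAt (𝓘(ℝ, E).prod 𝓘(ℝ, E)) 𝓘(ℝ, E) (fun p : D × D => p.1 * p.2)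
      (1, 1⁻¹) := (contMDiff_mul 𝓘(ℝ, E) ∞).mdifferentiable (by simp) _
  have hid : MDifferentiableAt 𝓘(ℝ, E) 𝓘(ℝ, E) (fun b : D => b) 1 := mdifferentiableAt_id
  have h1 : mfderiv 𝓘(ℝ, E) 𝓘(ℝ, E) ((fun p : D × D => p.1 * p.2) ∘ fun b : D => (b, b⁻¹)) 1
      (toTangent v) = 0 := by
    have : ((fun p : D × D => p.1 * p.2) ∘ fun b : D => (b, b⁻¹)) = fun _ => (1 : D) := by
      ext b; simp
    rw [this, mfderiv_const]; rfl
  rw [mfderiv_comp_apply (I' := 𝓘(ℝ, E).prod 𝓘(ℝ, E)) (1 : D) hm (hid.prodMk hinv),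
    mfderiv_prod_eq_add_apply hm, mfderiv_prodMk hid hinv] at h1
  have e1 : (fun z : D => z * (1 : D)⁻¹) = id := by ext; simp
  have e2 : (fun z : D => (1 : D) * z) = id := by ext; simp
  dsimp only at h1
  rw [e1, e2, mfderiv_id, mfderiv_id] at h1
  have h3 : (mfderiv 𝓘(ℝ, E) 𝓘(ℝ, E) (fun b : D => b) 1 (toTangent v) : E) = (toTangent v : E) := by
    have := mfderiv_id (I := 𝓘(ℝ, E)) (x := (1 : D))
    exact congrArg (fun f => f (toTangent v)) this
  refine (neg_eq_of_add_eq_zero_right (Eq.trans ?_ h1)).symm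
  exact congrArg (fun w : E => w + (show E from
    mfderiv 𝓘(ℝ, E) 𝓘(ℝ, E) (fun b : D => b⁻¹) 1 (toTangent v))) h3.symm

theorem mfderiv_inv_rightField (v : LieAlg E D) (a : D) :
    mfderiv 𝓘(ℝ, E) 𝓘(ℝ, E) (fun b : D => b⁻¹) a (rightField v a) =
      mulInvariantVectorField (-toTangent v) a⁻¹ := by
  have hinv (a : D) : MDifferentiableAt 𝓘(ℝ, E) 𝓘(ℝ, E) (fun b : D => b⁻¹) a :=
    (contMDiff_inv 𝓘(ℝ, E) ∞).mdifferentiable (by simp) a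
  have hl (b : D) : MDifferentiableAt 𝓘(ℝ, E) 𝓘(ℝ, E) (fun b : D => a⁻¹ * b) b :=
    (contMDiff_mul_left (I := 𝓘(ℝ, E)) (n := ∞)).mdifferentiable (by simp) b
  have hr : MDifferentiableAt 𝓘(ℝ, E) 𝓘(ℝ, E) (fun b : D => b * a) 1 :=
    (contMDiff_mul_right (I := 𝓘(ℝ, E)) (n := ∞)).mdifferentiable (by simp) 1
  have hfun : (fun b : D => b⁻¹) ∘ (fun b : D => b * a) = (fun b => a⁻¹ * b) ∘ fun b => b⁻¹ := by
    ext b; simp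
  have h1 := mfderiv_comp_apply (1 : D) (hinv (1 * a)) hr (toTangent v)
  rw [hfun, mfderiv_comp_apply (1 : D) (hl 1⁻¹) (hinv 1)] at h1
  refine (mfderiv_congr_pt _ (one_mul a).symm _).trans (h1.symm.trans ?_)
  refine (mfderiv_congr_pt (fun b : D => a⁻¹ * b) inv_one _).trans ?_
  exact congrArg (fun w : E => (show E from
    mfderiv 𝓘(ℝ, E) 𝓘(ℝ, E) (fun b : D => a⁻¹ * b) 1 w)) (mfderiv_inv_one v)

theorem mfderiv_inv_invertible (a : D) :
    (mfderiv 𝓘(ℝ, E) 𝓘(ℝ, E) (fun b : D => b⁻¹) a).IsInvertible := by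
  let Φ : Diffeomorph 𝓘(ℝ, E) 𝓘(ℝ, E) D D ∞ :=
    ⟨Equiv.inv D, contMDiff_inv 𝓘(ℝ, E) ∞, contMDiff_inv 𝓘(ℝ, E) ∞⟩
  exact ⟨Φ.mfderivToContinuousLinearEquiv (by simp) a, Φ.mfderivToContinuousLinearEquiv_coe (by simp)⟩

theorem rightField_eq (v : LieAlg E D) :
    rightField v = VectorField.mpullback 𝓘(ℝ, E) 𝓘(ℝ, E) (fun b : D => b⁻¹)
      (mulInvariantVectorField (-toTangent v)) := by
  funext a
  rw [VectorField.mpullback_apply, ← mfderiv_inv_rightField,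
    (mfderiv_inv_invertible a).inverse_apply_self]

variable [FiniteDimensional ℝ E]

/-- The bracket of right-invariant fields is the opposite of the bracket of left-invariant
fields, which is the one that `GroupLieAlgebra` carries. -/
theorem lieFun_eq (u v : LieAlg E D) : toTangent (lieFun u v) = - ⁅toTangent u, toTangent v⁆ := by
  have h3 : minSmoothness ℝ 3 ≤ ∞ := by
    rw [minSmoothness_of_isRCLikeNormedField]; exact WithTop.coe_le_coe.2 le_top
  have h2 : minSmoothness ℝ 2 ≤ ∞ := by
    rw [minSmoothness_of_isRCLikeNormedField]; exact WithTop.coe_le_coe.2 le_top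
  have : LieGroup 𝓘(ℝ, E) (minSmoothness ℝ 3) D := LieGroup.of_le h3
  have h := VectorField.mpullback_mlieBracket (n := ∞) (I := 𝓘(ℝ, E)) (I' := 𝓘(ℝ, E))
    (f := fun b : D => b⁻¹) (x₀ := 1)
    (V := mulInvariantVectorField (-toTangent u)) (W := mulInvariantVectorField (-toTangent v))
    (mdifferentiableAt_mulInvariantVectorField _) (mdifferentiableAt_mulInvariantVectorField _)
    (contMDiff_inv 𝓘(ℝ, E) ∞ 1) h2
  rw [← rightField_eq, ← rightField_eq, ← mulInvariantVector_mlieBracket,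
    ← GroupLieAlgebra.bracket_def, neg_lie, lie_neg, neg_neg] at h
  have h' := congrFun (rightField_eq (toTangent.symm (-⁅toTangent u, toTangent v⁆))) 1
  rw [rightField_one, ContinuousLinearEquiv.apply_symm_apply, neg_neg, h] at h'
  rw [h', lieFun, ContinuousLinearEquiv.apply_symm_apply]

theorem lieFun_bilinear : IsBilinearMap ℝ (lieFun (E := E) (D := D)) := by
  have h3 : minSmoothness ℝ 3 ≤ ∞ := by
    rw [minSmoothness_of_isRCLikeNormedField]; exact WithTop.coe_le_coe.2 le_top
  have : LieGroup 𝓘(ℝ, E) (minSmoothness ℝ 3) D := LieGroup.of_le h3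
  constructor
  · intro u u' v
    exact toTangent.injective (by simp only [lieFun_eq, map_add, add_lie, neg_add])
  · intro c u v
    exact toTangent.injective (by simp only [lieFun_eq, map_smul, smul_lie, smul_neg])
  · intro u v v'
    exact toTangent.injective (by simp only [lieFun_eq, map_add, lie_add, neg_add])
  · intro c u v
    exact toTangent.injective (by simp only [lieFun_eq, map_smul, lie_smul, smul_neg])

variable (E D) in
/-- The Lie bracket `[·, ·]_𝔡` of `lieFun`, as a bilinear map. -/
def lie : LieAlg E D →L[ℝ] LieAlg E D →L[ℝ] LieAlg E D :=
  (lieFun_bilinear (E := E) (D := D)).toContinuousBilinearMap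

end

/-- The adjoint action `Ad_a` of `a ∈ D` on `𝔡`: the derivative at `1` of `b ↦ a b a⁻¹`. -/
def Ad (a : D) (u : LieAlg E D) : LieAlg E D :=
  (mfderiv 𝓘(ℝ, E) 𝓘(ℝ, E) (fun b : D => a * b * a⁻¹) 1 (toTangent u) : E)

/-- `u ∈ 𝔡` is the velocity at `1` of a smooth curve that lies in the subgroup `G`. -/
def IsVelocity (G : Subgroup D) (u : LieAlg E D) : Prop :=
  ∃ γ : ℝ → D, ContMDiff 𝓘(ℝ, ℝ) 𝓘(ℝ, E) ∞ γ ∧ γ 0 = 1 ∧ (∀ t, γ t ∈ G) ∧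
    (mfderiv 𝓘(ℝ, ℝ) 𝓘(ℝ, E) γ 0 (1 : ℝ) : E) = (toTangent u : E)

variable (E) in
/-- The Lie algebra `𝔤 = T₁G ⊆ 𝔡` of a closed subgroup `G` of `D`: the velocities at `1` of the
smooth curves in `G`. (For a closed subgroup these already form a linear subspace, and taking
the span adds nothing.) -/
def lieSub (G : Subgroup D) : Submodule ℝ (LieAlg E D) :=
  Submodule.span ℝ {u | IsVelocity G u}

theorem Ad_mem_lieSub [LieGroup 𝓘(ℝ, E) ∞ D] (G : Subgroup D) (g : G) (u : LieAlg E D)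
    (hu : u ∈ lieSub E G) : Ad (g : D) u ∈ lieSub E G := by
  have hadd (u v : LieAlg E D) : Ad (g : D) (u + v) = Ad (g : D) u + Ad (g : D) v :=
    (congrArg _ (map_add toTangent u v)).trans (map_add (mfderiv 𝓘(ℝ, E) 𝓘(ℝ, E) _ _) _ _)
  have hsmul (c : ℝ) (u : LieAlg E D) : Ad (g : D) (c • u) = c • Ad (g : D) u :=
    (congrArg _ (map_smul toTangent c u)).trans (map_smul (mfderiv 𝓘(ℝ, E) 𝓘(ℝ, E) _ _) _ _)
  induction hu using Submodule.span_induction with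
  | zero =>
    have := hsmul 0 0
    rw [zero_smul, zero_smul] at this
    rw [this]; exact zero_mem _
  | add u v _ _ hu hv => rw [hadd]; exact add_mem hu hv
  | smul c u _ hu => rw [hsmul]; exact Submodule.smul_mem _ c hu
  | mem u hu =>
    obtain ⟨γ, hγ, h0, hG, hd⟩ := hu
    have hc : ContMDiff 𝓘(ℝ, E) 𝓘(ℝ, E) ∞ (fun b : D => (g : D) * b * (g : D)⁻¹) :=
      (contMDiff_mul_right (I := 𝓘(ℝ, E)) (n := ∞)).comp contMDiff_mul_left
    refine Submodule.subset_span ⟨fun t => (g : D) * γ t * (g : D)⁻¹, hc.comp hγ, by simp [h0],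
      fun t => G.mul_mem (G.mul_mem g.2 (hG t)) (G.inv_mem g.2), ?_⟩
    have h1 := mfderiv_comp_apply (0 : ℝ) (hc.mdifferentiable (by simp) (γ 0))
      (hγ.mdifferentiable (by simp) 0) (1 : ℝ)
    refine h1.trans ((mfderiv_congr_pt _ h0 _).trans ?_)
    exact congrArg (fun w : E => (show E from
      mfderiv 𝓘(ℝ, E) 𝓘(ℝ, E) (fun b : D => (g : D) * b * (g : D)⁻¹) 1 w)) hd

/-- The adjoint action of `g ∈ G` on `𝔤`. -/
def adSub [LieGroup 𝓘(ℝ, E) ∞ D] (G : Subgroup D) (g : G) (v : lieSub E G) : lieSub E G :=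
  ⟨Ad (g : D) (v : LieAlg E D), Ad_mem_lieSub G g _ v.2⟩

end LieAlg

/-! ### Manin pairs, the dressing action, and connection splittings -/

section Manin

variable {E : Type*} [NormedAddCommGroup E] [NormedSpace ℝ E]
  {D : Type*} [TopologicalSpace D] [ChartedSpace E D] [Group D]

/-- A subspace is isotropic for the bilinear form `B`. -/
def IsIsotropic (B : LinearMap.BilinForm ℝ (LieAlg E D)) (N : Submodule ℝ (LieAlg E D)) : Prop :=
  ∀ u ∈ N, ∀ v ∈ N, B u v = 0

/-- `(𝔡, 𝔤)`, with the form `B = ⟨·, ·⟩_𝔡`, is a Manin pair with `dim 𝔡 = 2n`, integrated by the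
group pair `(D, G)`. -/
structure IsManinPair [FiniteDimensional ℝ E] [LieGroup 𝓘(ℝ, E) ∞ D] (G : Subgroup D)
    (B : LinearMap.BilinForm ℝ (LieAlg E D)) (n : ℕ) : Prop where
  finrank_eq : Module.finrank ℝ (LieAlg E D) = 2 * n
  symm : ∀ u v, B u v = B v u
  nondegenerate : B.Nondegenerate
  sigPos_eq : sigPos (LinearMap.BilinMap.toQuadraticMap B) = n
  sigNeg_eq : sigNeg (LinearMap.BilinMap.toQuadraticMap B) = n
  ad_invariant : ∀ (a : D) (u v : LieAlg E D), B (Ad a u) (Ad a v) = B u v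
  lie_mem : ∀ u ∈ lieSub E G, ∀ v ∈ lieSub E G, lie E D u v ∈ lieSub E G
  maximal_isotropic : Maximal (IsIsotropic B) (lieSub E G)

variable {F : Type*} [NormedAddCommGroup F] [NormedSpace ℝ F] {G : Subgroup D}
  [ChartedSpace F (D ⧸ G)]

variable (F) in
/-- The infinitesimal dressing action `ρ_S : 𝔡 → 𝔛(S)` on `S = D/G`: the value at `x` is the
derivative at `a = 1` of `a ↦ a • x`. -/
def rho (u : LieAlg E D) (x : D ⧸ G) : TangentSpace 𝓘(ℝ, F) x :=
  (mfderiv 𝓘(ℝ, E) 𝓘(ℝ, F) (fun a : D => a • x) 1 (toTangent u) : F)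

/-- A connection splitting, that is, an isotropic splitting `s : TS → 𝔡_S = 𝔡 × S` of
`ρ_S : 𝔡_S → TS`. It is given by a smooth 1-form `s ∈ Ω¹(S, 𝔡)` with `ρ_S ∘ s = id`. -/
structure IsConnectionSplitting (B : LinearMap.BilinForm ℝ (LieAlg E D))
    (s : ∀ x : D ⧸ G, TangentSpace 𝓘(ℝ, F) x →L[ℝ] LieAlg E D) : Prop where
  smooth : IsSmoothForm (oneForm s)
  rho_apply : ∀ (x : D ⧸ G) (X : TangentSpace 𝓘(ℝ, F) x), rho F (s x X) x = X
  isotropic : ∀ (x : D ⧸ G) (X Y : TangentSpace 𝓘(ℝ, F) x), B (s x X) (s x Y) = 0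

/-- `s` is `G`-equivariant for the dressing action on `TS` and the action
`g.(x, u) = (gx, Ad_g u)` on `𝔡_S`. -/
def IsEquivariant (s : ∀ x : D ⧸ G, TangentSpace 𝓘(ℝ, F) x →L[ℝ] LieAlg E D) : Prop :=
  ∀ (g : G) (x : D ⧸ G) (X : TangentSpace 𝓘(ℝ, F) x),
    s ((g : D) • x) (mfderiv 𝓘(ℝ, F) 𝓘(ℝ, F) (fun y : D ⧸ G => (g : D) • y) x X) =
      Ad (g : D) (s x X)

variable [FiniteDimensional ℝ E]

/-- The 3-form `φ_S = ½⟨ds, s⟩_𝔡 + ⅙⟨[s, s]_𝔡, s⟩_𝔡` on `S`. -/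
def phi [LieGroup 𝓘(ℝ, E) ∞ D] (B : LinearMap.BilinForm ℝ (LieAlg E D))
    (s : ∀ x : D ⧸ G, TangentSpace 𝓘(ℝ, F) x →L[ℝ] LieAlg E D) : FormField F (D ⧸ G) 3 ℝ :=
  (1 / 2 : ℝ) • wedge (LinearMap.toContinuousBilinearMap B) (extD (oneForm s)) (oneForm s) +
  (1 / 6 : ℝ) • wedge (LinearMap.toContinuousBilinearMap B)
    (wedge (lie E D) (oneForm s) (oneForm s)) (oneForm s)

/-- The 1-form `σ(v) = ⟨s(·), v⟩_𝔡` on `S`, for `v ∈ 𝔤`. -/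
def sigma (B : LinearMap.BilinForm ℝ (LieAlg E D))
    (s : ∀ x : D ⧸ G, TangentSpace 𝓘(ℝ, F) x →L[ℝ] LieAlg E D) (v : lieSub E G) :
    FormField F (D ⧸ G) 1 ℝ :=
  oneForm fun x => ((LinearMap.toContinuousBilinearMap B).flip (v : LieAlg E D)).comp (s x)

/-! ### The Cartan model -/

variable (E F G) in
/-- Maps `P` from `𝔤` to the (inhomogeneous) forms on `S`; `P v j` is the component of `P(v)` in
degree `j`. -/
abbrev CartanMap : Type _ := lieSub E G → ∀ j : ℕ, FormField F (D ⧸ G) j ℝ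

/-- `P` is an element of the degree `k` part
`Ω^k_G(S) = (⨁_{2i+j=k} S^i(𝔤*) ⊗ Ω^j(S))^G` of the Cartan complex for the dressing action: its
component in `Ω^j(S)` is a homogeneous polynomial in `v ∈ 𝔤` of degree `i` with `2i + j = k` (and
is zero if there is no such `i`), its values are smooth forms, and it is `G`-invariant, that is,
`g^* (P(Ad_g v)) = P(v)`. -/
structure IsCartanCochain [LieGroup 𝓘(ℝ, E) ∞ D] (k : ℕ) (P : CartanMap E F G) : Prop where
  homogeneous : ∀ i j : ℕ, 2 * i + j = k →
    ∃ m : MultilinearMap ℝ (fun _ : Fin i => lieSub E G) (FormField F (D ⧸ G) j ℝ),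
      ∀ v, P v j = m fun _ => v
  eq_zero : ∀ j : ℕ, (∀ i : ℕ, 2 * i + j ≠ k) → ∀ v, P v j = 0
  smooth : ∀ v j, IsSmoothForm (P v j)
  invariant : ∀ (g : G) (v : lieSub E G) (j : ℕ),
    pullback (fun y : D ⧸ G => (g : D) • y) (P (adSub G g v) j) = P v j

/-- The Cartan differential `(d_G P)(v) = d(P(v)) - i_{ρ(v)}(P(v))`. -/
def cartanD (P : CartanMap E F G) : CartanMap E F G := fun v j =>
  match j with
  | 0 => -contract (rho F (v : LieAlg E D)) (P v 1)
  | j + 1 => extD (P v j) - contract (rho F (v : LieAlg E D)) (P v (j + 2))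

/-- The element `σ + φ_S`, that is, `v ↦ σ(v) + φ_S`. -/
def sigmaPlusPhi [LieGroup 𝓘(ℝ, E) ∞ D] (B : LinearMap.BilinForm ℝ (LieAlg E D))
    (s : ∀ x : D ⧸ G, TangentSpace 𝓘(ℝ, F) x →L[ℝ] LieAlg E D) : CartanMap E F G := fun v j =>
  match j with
  | 1 => sigma B s v
  | 3 => phi B s
  | _ => 0

end Manin

end GroupPair

end

/-! The proof turns on the curvature `F(X, Y) = ds(X, Y) + [s X, s Y]` of the splitting (`curv`).
The map `ρ_S` is a Lie algebra homomorphism for the bracket of right-invariant fields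
(`lieBracket_generator`), so differentiating `ρ_S ∘ s = id` shows that `F` takes values in the
kernel of `ρ_S` (`rhoL_curv`). At the point `[a]` this kernel lies in `Ad_a 𝔤`, and it is therefore
isotropic (`rho_ker_isotropic`).

The form `φ_S` is the Chern–Simons form of `s`, so `dφ_S = ½⟨F ∧ F⟩` by invariance of the form and
the Jacobi identity (`csForm_closed`). The right side pairs elements of an isotropic space, hence
`dφ_S = 0` (`extD_phi`).

For `v ∈ 𝔤` the vector `v - s(ρ(v))` also lies in the kernel. Pairing it with itself gives `i_{ρ(v)}
σ(v) = 0` (`contract_sigma`). Pairing it with `F` gives `⟨F, s(ρ(v))⟩ = ⟨F, v⟩`. Together with the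
derivative of the isotropy condition (`fderiv_isotropic`) and the infinitesimal equivariance
`L_{ρ(v)} s = [s, v]` (`infinitesimal_equivariance_splitting`), this yields `dσ(v) = i_{ρ(v)} φ_S`
(`csForm_generator`, `extD_sigma`).

Invariance of `σ` and `φ_S` under `G` holds because `Ad_g` preserves the form and the bracket
(`lie_Ad`), and `d` commutes with pullbacks (`extD_pullback`).

The analysis takes place in the chart of `D` at `1` and the chart of `S` at `x`, where `D` becomes a
local group acting on an open set. Symmetry of second derivatives and smooth curves in `G` replace
flows and the exponential map. -/

namespace GroupPair

/-! ### Calculus of local groups and local actions on normed spaces -/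

section LocalCalculus

variable {E : Type*} [NormedAddCommGroup E] [NormedSpace ℝ E]
  {F : Type*} [NormedAddCommGroup F] [NormedSpace ℝ F]
  {V : Type*} [NormedAddCommGroup V] [NormedSpace ℝ V]

theorem fderiv_partial_left {f : E × F → V} {a : E} {y : F} (hf : DifferentiableAt ℝ f (a, y))
    (u : E) : fderiv ℝ (fun a => f (a, y)) a u = fderiv ℝ f (a, y) (u, 0) := by
  have : HasFDerivAt (fun a => f (a, y)) _ a :=
    HasFDerivAt.comp (f := fun a => (a, y)) a hf.hasFDerivAt (hasFDerivAt_prodMk_left a y)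
  simp [this.fderiv]

theorem fderiv_partial_right {f : E × F → V} {a : E} {y : F} (hf : DifferentiableAt ℝ f (a, y))
    (X : F) : fderiv ℝ (fun y => f (a, y)) y X = fderiv ℝ f (a, y) (0, X) := by
  have : HasFDerivAt (fun y => f (a, y)) _ y :=
    HasFDerivAt.comp (f := fun y => (a, y)) y hf.hasFDerivAt (hasFDerivAt_prodMk_right a y)
  simp [this.fderiv]

theorem eventually_differentiableAt {f : E → V} {x : E} (hf : ContDiffAt ℝ 2 f x) :
    ∀ᶠ z in 𝓝 x, DifferentiableAt ℝ f z :=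
  (hf.eventually (by simp)).mono fun _ h => h.differentiableAt (by simp)

theorem hasFDerivAt_fderiv {f : E → V} {x : E} (hf : ContDiffAt ℝ 2 f x) :
    HasFDerivAt (fderiv ℝ f) (fderiv ℝ (fderiv ℝ f) x) x :=
  ((hf.fderiv_right (m := 1) (by norm_num)).differentiableAt (by simp)).hasFDerivAt

theorem snd_fderiv_symm {f : E → V} {x : E} (hf : ContDiffAt ℝ 2 f x) (v w : E) :
    fderiv ℝ (fderiv ℝ f) x v w = fderiv ℝ (fderiv ℝ f) x w v :=
  (hf.isSymmSndFDerivAt (by simp)) v w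

theorem hasFDerivAt_fderiv_left {f : E × F → V} {a : E} {y : F} (hf : ContDiffAt ℝ 2 f (a, y)) :
    HasFDerivAt (fun b => fderiv ℝ f (b, y))
      ((fderiv ℝ (fderiv ℝ f) (a, y)).comp (ContinuousLinearMap.inl ℝ E F)) a :=
  HasFDerivAt.comp (f := fun b => (b, y)) a (hasFDerivAt_fderiv hf) (hasFDerivAt_prodMk_left a y)

theorem hasFDerivAt_fderiv_right {f : E × F → V} {a : E} {y : F} (hf : ContDiffAt ℝ 2 f (a, y)) :
    HasFDerivAt (fun z => fderiv ℝ f (a, z))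
      ((fderiv ℝ (fderiv ℝ f) (a, y)).comp (ContinuousLinearMap.inr ℝ E F)) y :=
  HasFDerivAt.comp (f := fun z => (a, z)) y (hasFDerivAt_fderiv hf) (hasFDerivAt_prodMk_right a y)

/-- The infinitesimal generator at `e` of a family of maps `Φ (a, ·)`. -/
noncomputable def generator (Φ : E × F → V) (e : E) (u : E) (y : F) : V :=
  fderiv ℝ (fun a => Φ (a, y)) e u

theorem eventually_generator_eq {Φ : E × F → V} {e : E} {y : F} (hΦ : ContDiffAt ℝ 2 Φ (e, y))
    (u : E) : generator Φ e u =ᶠ[𝓝 y] fun z => fderiv ℝ Φ (e, z) (u, 0) := by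
  have h : Filter.Tendsto (fun z : F => (e, z)) (𝓝 y) (𝓝 (e, y)) :=
    (Continuous.prodMk_right e).tendsto y
  filter_upwards [h.eventually (eventually_differentiableAt hΦ)] with z hz
  exact fderiv_partial_left hz u

theorem generator_eq {Φ : E × F → V} {e : E} {y : F} (hΦ : ContDiffAt ℝ 2 Φ (e, y))
    (u : E) : generator Φ e u y = fderiv ℝ Φ (e, y) (u, 0) :=
  (eventually_generator_eq hΦ u).self_of_nhds

/-- A generator is a partial derivative of `Φ`, so its own derivative is a mixed second derivative.
This reduces every bracket of generators to the symmetry of `D²Φ`. -/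
theorem hasFDerivAt_generator {Φ : E × F → V} {e : E} {y : F} (hΦ : ContDiffAt ℝ 2 Φ (e, y))
    (u : E) : HasFDerivAt (generator Φ e u)
      (((fderiv ℝ (fderiv ℝ Φ) (e, y)).comp (ContinuousLinearMap.inr ℝ E F)).flip (u, 0)) y := by
  refine HasFDerivAt.congr_of_eventuallyEq ?_ (eventually_generator_eq hΦ u)
  simpa using (hasFDerivAt_fderiv_right hΦ).clm_apply (hasFDerivAt_const ((u, 0) : E × F) y)

theorem fderiv_generator {Φ : E × F → V} {e : E} {y : F} (hΦ : ContDiffAt ℝ 2 Φ (e, y))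
    (u : E) (X : F) : fderiv ℝ (generator Φ e u) y X = fderiv ℝ (fderiv ℝ Φ) (e, y) (0, X) (u, 0) := by
  rw [(hasFDerivAt_generator hΦ u).fderiv]; simp

/-- The generators of a local action satisfy the bracket relations of the right-invariant
vector fields of the local group. -/
theorem lieBracket_generator {m : E × E → E} {Φ : E × F → F} {e : E} {y : F}
    (hm : ContDiffAt ℝ 2 m (e, e)) (hΦ : ContDiffAt ℝ 2 Φ (e, y))
    (hml : ∀ᶠ b in 𝓝 e, m (e, b) = b) (hmr : ∀ᶠ b in 𝓝 e, m (b, e) = b) (hy : Φ (e, y) = y)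
    (hact : ∀ᶠ b in 𝓝 e, ∀ᶠ a in 𝓝 e, Φ (m (a, b), y) = Φ (a, Φ (b, y))) (u v : E) :
    VectorField.lieBracket ℝ (generator Φ e u) (generator Φ e v) y =
      generator Φ e (VectorField.lieBracket ℝ (generator m e u) (generator m e v) e) y := by
  have hmee : m (e, e) = e := hml.self_of_nhds
  have hgen (u : E) : generator m e u e = u := by
    have : (fun a => m (a, e)) =ᶠ[𝓝 e] id := hmr
    rw [generator, this.fderiv_eq]; simp
  -- The first term on the right is symmetric in `u` and `v`, so it drops out of the bracket; the
  -- second gives the bracket in the group.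
  have key (u v : E) : fderiv ℝ (generator Φ e u) y (generator Φ e v y) =
      fderiv ℝ (fderiv ℝ Φ) (e, y) (v, 0) (u, 0) +
        generator Φ e (fderiv ℝ (generator m e u) e v) y := by
    have hb : Filter.Tendsto (fun b : E => (b, y)) (𝓝 e) (𝓝 (e, y)) :=
      (Continuous.prodMk_left y).tendsto e
    have hb' : Filter.Tendsto (fun b : E => (e, b)) (𝓝 e) (𝓝 (e, e)) :=
      (Continuous.prodMk_right e).tendsto e
    have hΦb : HasFDerivAt (fun b => Φ (b, y)) ((fderiv ℝ Φ (e, y)).comp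
        (ContinuousLinearMap.inl ℝ E F)) e :=
      (hΦ.differentiableAt (by simp)).hasFDerivAt.comp e (hasFDerivAt_prodMk_left e y)
    have hΦt : Filter.Tendsto (fun b => Φ (b, y)) (𝓝 e) (𝓝 y) := by
      have := hΦb.continuousAt.tendsto; rwa [hy] at this
    -- The action law `Φ(m(a, b), y) = Φ(a, Φ(b, y))` differentiated in `a` at `e`: the orbit map
    -- carries the right-invariant field to the generator. Differentiating once more in `b` gives
    -- `key`.
    have hev : (fun b => fderiv ℝ Φ (b, y) (generator m e u b, 0)) =ᶠ[𝓝 e]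
        fun b => generator Φ e u (Φ (b, y)) := by
      filter_upwards [hact, hml, hb.eventually (eventually_differentiableAt hΦ),
        hb'.eventually (eventually_differentiableAt hm)] with b h1 h2 h3 h4
      have h5 : DifferentiableAt ℝ (fun a => m (a, b)) e :=
        h4.comp e (hasFDerivAt_prodMk_left e b).differentiableAt
      have h6 : HasFDerivAt (fun a => Φ (m (a, b), y)) _ e :=
        (h2.symm ▸ h3.hasFDerivAt : HasFDerivAt Φ (fderiv ℝ Φ (b, y)) (m (e, b), y)).comp e
          (h5.hasFDerivAt.prodMk (hasFDerivAt_const y e))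
      rw [generator, generator, ← Filter.EventuallyEq.fderiv_eq h1, h6.fderiv]
      simp
    have hgm := hasFDerivAt_generator hm u
    have hL := (hasFDerivAt_fderiv_left hΦ).clm_apply
      (hgm.prodMk (hasFDerivAt_const (0 : F) e))
    have hg : HasFDerivAt (generator Φ e u) (fderiv ℝ (generator Φ e u) y) (Φ (e, y)) := by
      rw [hy]; exact (hasFDerivAt_generator hΦ u).differentiableAt.hasFDerivAt
    have hR : HasFDerivAt (fun b => generator Φ e u (Φ (b, y))) _ e :=
      HasFDerivAt.comp (f := fun b => Φ (b, y)) e hg hΦb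
    have h := (hL.congr_of_eventuallyEq hev.symm).unique hR
    have h' := congrArg (fun l => l v) h
    rw [hgm.fderiv, generator_eq hΦ, generator_eq hΦ]
    simpa [hgen, add_comm] using h'.symm
  rw [VectorField.lieBracket, VectorField.lieBracket, key, key, hgen, hgen, snd_fderiv_symm hΦ,
    add_sub_add_left_eq_sub]
  simp only [generator_eq hΦ]
  rw [← map_sub]; simp

/-- The derivative of conjugation in a local group. -/
theorem hasFDerivAt_conj {m c : E × E → E} {e : E}
    (hm : ContDiffAt ℝ 2 m (e, e)) (hc : ContDiffAt ℝ 2 c (e, e))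
    (hml : ∀ᶠ b in 𝓝 e, m (e, b) = b) (hmr : ∀ᶠ b in 𝓝 e, m (b, e) = b)
    (hce : ∀ᶠ a in 𝓝 e, c (a, e) = e)
    (hconj : ∀ᶠ a in 𝓝 e, ∀ᶠ b in 𝓝 e, m (c (a, b), a) = m (a, b)) (u : E) :
    ∃ A : E →L[ℝ] E, HasFDerivAt (fun a => fderiv ℝ (fun b => c (a, b)) e u) A e ∧
      ∀ v, A v = VectorField.lieBracket ℝ (generator m e u) (generator m e v) e := by
  have hmee : m (e, e) = e := hml.self_of_nhds
  have hgen (u : E) : generator m e u e = u := by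
    have : (fun a => m (a, e)) =ᶠ[𝓝 e] id := hmr
    rw [generator, this.fderiv_eq]; simp
  have hm1 (u : E) : fderiv ℝ m (e, e) (u, 0) = u := by rw [← generator_eq hm, hgen]
  have hm2 (u : E) : fderiv ℝ m (e, e) (0, u) = u := by
    have : (fun a => m (e, a)) =ᶠ[𝓝 e] id := hml
    rw [← fderiv_partial_right (hm.differentiableAt (by simp)), this.fderiv_eq]; simp
  have hl : Filter.Tendsto (fun b : E => (b, e)) (𝓝 e) (𝓝 (e, e)) :=
    (Continuous.prodMk_left e).tendsto e
  have hr : Filter.Tendsto (fun b : E => (e, b)) (𝓝 e) (𝓝 (e, e)) :=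
    (Continuous.prodMk_right e).tendsto e
  have hA : (fun a => fderiv ℝ (fun b => c (a, b)) e u) =ᶠ[𝓝 e]
      fun a => fderiv ℝ c (a, e) (0, u) := by
    filter_upwards [hl.eventually (eventually_differentiableAt hc)] with a ha
    exact fderiv_partial_right ha u
  obtain ⟨A, hA'⟩ : ∃ A : E →L[ℝ] E,
      HasFDerivAt (fun a => fderiv ℝ (fun b => c (a, b)) e u) A e :=
    ⟨_, ((hasFDerivAt_fderiv_left hc).clm_apply
      (hasFDerivAt_const ((0, u) : E × E) e)).congr_of_eventuallyEq hA⟩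
  refine ⟨A, hA', fun v => ?_⟩
  -- The relation `(a b a⁻¹) a = a b` differentiated in `b` at the unit. Its derivative in `a` at
  -- the unit then expresses `A v` as a difference of two mixed second derivatives of `m`, which is
  -- the bracket.
  have hev : (fun a => fderiv ℝ m (e, a) (fderiv ℝ (fun b => c (a, b)) e u, 0)) =ᶠ[𝓝 e]
      fun a => fderiv ℝ m (a, e) (0, u) := by
    filter_upwards [hconj, hce, hl.eventually (eventually_differentiableAt hm),
      hr.eventually (eventually_differentiableAt hm),
      hl.eventually (eventually_differentiableAt hc)] with a h1 h2 h3 h4 h5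
    have h6 : DifferentiableAt ℝ (fun b => c (a, b)) e :=
      h5.comp e (hasFDerivAt_prodMk_right a e).differentiableAt
    have h7 : HasFDerivAt (fun b => m (c (a, b), a)) _ e :=
      (h2.symm ▸ h4.hasFDerivAt : HasFDerivAt m (fderiv ℝ m (e, a)) (c (a, e), a)).comp e
        (h6.hasFDerivAt.prodMk (hasFDerivAt_const a e))
    rw [← fderiv_partial_right h3, ← Filter.EventuallyEq.fderiv_eq h1, h7.fderiv]
    simp
  have hAe : fderiv ℝ (fun b => c (e, b)) e u = u := by
    have := hev.self_of_nhds
    simp only at this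
    rwa [hm1, hm2] at this
  have hL := (hasFDerivAt_fderiv_right hm).clm_apply
    (hA'.prodMk (hasFDerivAt_const (0 : E) e))
  have hR := (hasFDerivAt_fderiv_left hm).clm_apply
    (hasFDerivAt_const ((0, u) : E × E) e)
  have h := congrArg (fun l => l v) ((hL.congr_of_eventuallyEq hev.symm).unique hR)
  have h' : A v + fderiv ℝ (fderiv ℝ m) (e, e) (0, v) (u, 0) =
      fderiv ℝ (fderiv ℝ m) (e, e) (v, 0) (0, u) := by
    simpa [hAe, hm1] using h
  rw [VectorField.lieBracket, hgen, hgen, fderiv_generator hm, fderiv_generator hm,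
    snd_fderiv_symm hm (0, u), ← h', add_sub_cancel_right]

/-- Infinitesimal form of the equivariance of a vector-valued one-form under a curve in a local
transformation group. -/
theorem infinitesimal_equivariance {Φ : E × F → F} {e : E} {y : F} {s : F → F →L[ℝ] V}
    (hΦ : ContDiffAt ℝ 2 Φ (e, y)) (hone : ∀ᶠ z in 𝓝 y, Φ (e, z) = z)
    (hs : DifferentiableAt ℝ s y) {γ : ℝ → E} {v : E} (hγ : HasDerivAt γ v 0) (hγe : γ 0 = e)
    {α : ℝ → V} {α' : V} (hα : HasDerivAt α α' 0) (X : F)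
    (heq : ∀ᶠ t in 𝓝 (0 : ℝ), s (Φ (γ t, y)) (fderiv ℝ (fun z => Φ (γ t, z)) y X) = α t) :
    fderiv ℝ s y (generator Φ e v y) X + s y (fderiv ℝ (generator Φ e v) y X) = α' := by
  subst hγe
  have hy : Φ (γ 0, y) = y := hone.self_of_nhds
  have hX : fderiv ℝ Φ (γ 0, y) (0, X) = X := by
    have : (fun z => Φ (γ 0, z)) =ᶠ[𝓝 y] id := hone
    rw [← fderiv_partial_right (hΦ.differentiableAt (by simp)), this.fderiv_eq]; simp
  have hcurve : HasDerivAt (fun t => (γ t, y)) (v, (0 : F)) 0 := hγ.prodMk (hasDerivAt_const 0 y)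
  have h1 : HasDerivAt (fun t => Φ (γ t, y)) (fderiv ℝ Φ (γ 0, y) (v, 0)) 0 :=
    (hΦ.differentiableAt (by simp)).hasFDerivAt.comp_hasDerivAt (0 : ℝ) hcurve
  have h2 : HasDerivAt (fun t => s (Φ (γ t, y))) (fderiv ℝ s y (fderiv ℝ Φ (γ 0, y) (v, 0))) 0 :=
    (hy.symm ▸ hs.hasFDerivAt : HasFDerivAt s (fderiv ℝ s y) (Φ (γ 0, y))).comp_hasDerivAt
      (0 : ℝ) h1
  have h3 : HasDerivAt (fun t => fderiv ℝ Φ (γ t, y))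
      (fderiv ℝ (fderiv ℝ Φ) (γ 0, y) (v, 0)) 0 :=
    (hasFDerivAt_fderiv hΦ).comp_hasDerivAt (0 : ℝ) hcurve
  have h4 := h2.clm_apply (h3.clm_apply (hasDerivAt_const (0 : ℝ) ((0, X) : E × F)))
  have hev : (fun t => s (Φ (γ t, y)) (fderiv ℝ Φ (γ t, y) (0, X))) =ᶠ[𝓝 0] α := by
    filter_upwards [heq, hcurve.continuousAt.eventually (eventually_differentiableAt hΦ)]
      with t ht ht'
    rw [← ht, fderiv_partial_right ht']
  have h5 := (hα.congr_of_eventuallyEq hev).unique h4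
  rw [generator_eq hΦ, fderiv_generator hΦ, snd_fderiv_symm hΦ, h5]
  simp [hX, hy]

end LocalCalculus

/-! ### Tangent maps in charts -/

section Charts

variable {E : Type*} [NormedAddCommGroup E] [NormedSpace ℝ E]
  {M : Type*} [TopologicalSpace M] [ChartedSpace E M]
  {E' : Type*} [NormedAddCommGroup E'] [NormedSpace ℝ E']
  {N : Type*} [TopologicalSpace N] [ChartedSpace E' N]
  {E'' : Type*} [NormedAddCommGroup E''] [NormedSpace ℝ E'']
  {P : Type*} [TopologicalSpace P] [ChartedSpace E'' P]

/-- The tangent map of `f` at `x`, as a continuous linear map between the model spaces. -/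
noncomputable def tmap (E E' : Type*) [NormedAddCommGroup E] [NormedSpace ℝ E]
    [NormedAddCommGroup E'] [NormedSpace ℝ E'] {M : Type*} [TopologicalSpace M] [ChartedSpace E M]
    {N : Type*} [TopologicalSpace N] [ChartedSpace E' N] (f : M → N) (x : M) : E →L[ℝ] E' :=
  mfderiv 𝓘(ℝ, E) 𝓘(ℝ, E') f x

theorem tmap_comp {g : N → P} {f : M → N} (x : M)
    (hg : MDifferentiableAt 𝓘(ℝ, E') 𝓘(ℝ, E'') g (f x))
    (hf : MDifferentiableAt 𝓘(ℝ, E) 𝓘(ℝ, E') f x) :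
    tmap E E'' (fun z => g (f z)) x = (tmap E' E'' g (f x)).comp (tmap E E' f x) :=
  mfderiv_comp x hg hf

theorem tmap_id (x : M) : tmap E E (fun z : M => z) x = ContinuousLinearMap.id ℝ E :=
  mfderiv_id

theorem tmap_congr {f g : M → N} {x : M} (h : f =ᶠ[𝓝 x] g) : tmap E E' f x = tmap E E' g x :=
  h.mfderiv_eq

theorem tmap_eq_fderiv (f : E → E') (x : E) : tmap E E' f x = fderiv ℝ f x :=
  mfderiv_eq_fderiv

theorem mdifferentiableAt_chart [IsManifold 𝓘(ℝ, E) ∞ M] {x p : M}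
    (hp : p ∈ (extChartAt 𝓘(ℝ, E) x).source) :
    MDifferentiableAt 𝓘(ℝ, E) 𝓘(ℝ, E) (extChartAt 𝓘(ℝ, E) x) p :=
  (contMDiffAt_extChartAt' (n := ∞) (by rwa [extChartAt_source] at hp)).mdifferentiableAt (by simp)

theorem contMDiffAt_chart_symm [IsManifold 𝓘(ℝ, E) ∞ M] {x : M} {z : E}
    (hz : z ∈ (extChartAt 𝓘(ℝ, E) x).target) :
    ContMDiffAt 𝓘(ℝ, E) 𝓘(ℝ, E) ∞ (extChartAt 𝓘(ℝ, E) x).symm z :=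
  (contMDiffOn_extChartAt_symm x).contMDiffAt (extChartAt_target_mem_nhds' hz)

theorem mdifferentiableAt_chart_symm [IsManifold 𝓘(ℝ, E) ∞ M] {x : M} {z : E}
    (hz : z ∈ (extChartAt 𝓘(ℝ, E) x).target) :
    MDifferentiableAt 𝓘(ℝ, E) 𝓘(ℝ, E) (extChartAt 𝓘(ℝ, E) x).symm z :=
  (contMDiffAt_chart_symm hz).mdifferentiableAt (by simp)

/-- The tangent space at `x` is identified with the model space through the preferred chart at `x`,
so this chart has trivial derivative at its own centre. Elsewhere in the chart domain the derivative
is a genuine coordinate change. -/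
theorem tmap_chart_self [IsManifold 𝓘(ℝ, E) ∞ M] (x : M) :
    tmap E E (extChartAt 𝓘(ℝ, E) x) x = ContinuousLinearMap.id ℝ E := by
  have : IsManifold 𝓘(ℝ, E) 1 M := IsManifold.of_le (n := ∞) (by simp)
  exact mfderiv_extChartAt_self

theorem tmap_chart_comp_symm [IsManifold 𝓘(ℝ, E) ∞ M] {x : M} {z : E}
    (hz : z ∈ (extChartAt 𝓘(ℝ, E) x).target) :
    (tmap E E (extChartAt 𝓘(ℝ, E) x) ((extChartAt 𝓘(ℝ, E) x).symm z)).comp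
      (tmap E E (extChartAt 𝓘(ℝ, E) x).symm z) = ContinuousLinearMap.id ℝ E := by
  rw [← tmap_comp z (mdifferentiableAt_chart ((extChartAt 𝓘(ℝ, E) x).map_target hz))
    (mdifferentiableAt_chart_symm hz), ← tmap_id z]
  refine tmap_congr ?_
  filter_upwards [extChartAt_target_mem_nhds' hz] with w hw
  exact (extChartAt 𝓘(ℝ, E) x).right_inv hw

theorem tmap_symm_comp_chart [IsManifold 𝓘(ℝ, E) ∞ M] {x p : M}
    (hp : p ∈ (extChartAt 𝓘(ℝ, E) x).source) :
    (tmap E E (extChartAt 𝓘(ℝ, E) x).symm (extChartAt 𝓘(ℝ, E) x p)).comp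
      (tmap E E (extChartAt 𝓘(ℝ, E) x) p) = ContinuousLinearMap.id ℝ E := by
  rw [← tmap_comp p (mdifferentiableAt_chart_symm ((extChartAt 𝓘(ℝ, E) x).map_source hp))
    (mdifferentiableAt_chart hp), ← tmap_id p]
  refine tmap_congr ?_
  filter_upwards [extChartAt_source_mem_nhds' hp] with w hw
  exact (extChartAt 𝓘(ℝ, E) x).left_inv hw

theorem tmap_symm_self [IsManifold 𝓘(ℝ, E) ∞ M] (x : M) :
    tmap E E (extChartAt 𝓘(ℝ, E) x).symm (extChartAt 𝓘(ℝ, E) x x) =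
      ContinuousLinearMap.id ℝ E := by
  have := tmap_symm_comp_chart (mem_extChartAt_source (I := 𝓘(ℝ, E)) x)
  rwa [tmap_chart_self, ContinuousLinearMap.comp_id] at this

/-- The tangent map in charts is the derivative of the expression of the map in charts. -/
theorem tmap_in_charts [IsManifold 𝓘(ℝ, E) ∞ M] [IsManifold 𝓘(ℝ, E') ∞ N] {f : M → N} {x : M}
    {y : N} {z : E} (hz : z ∈ (extChartAt 𝓘(ℝ, E) x).target)
    (hf : MDifferentiableAt 𝓘(ℝ, E) 𝓘(ℝ, E') f ((extChartAt 𝓘(ℝ, E) x).symm z))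
    (hy : f ((extChartAt 𝓘(ℝ, E) x).symm z) ∈ (extChartAt 𝓘(ℝ, E') y).source) :
    fderiv ℝ (fun w => extChartAt 𝓘(ℝ, E') y (f ((extChartAt 𝓘(ℝ, E) x).symm w))) z =
      (tmap E' E' (extChartAt 𝓘(ℝ, E') y) (f ((extChartAt 𝓘(ℝ, E) x).symm z))).comp
        ((tmap E E' f ((extChartAt 𝓘(ℝ, E) x).symm z)).comp
          (tmap E E (extChartAt 𝓘(ℝ, E) x).symm z)) := by
  rw [← tmap_eq_fderiv, ← tmap_comp z hf (mdifferentiableAt_chart_symm hz)]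
  exact tmap_comp z (mdifferentiableAt_chart hy) (hf.comp z (mdifferentiableAt_chart_symm hz))

theorem tmap_in_charts_self [IsManifold 𝓘(ℝ, E) ∞ M] [IsManifold 𝓘(ℝ, E') ∞ N] {f : M → N} {x : M}
    {y : N} (hf : MDifferentiableAt 𝓘(ℝ, E) 𝓘(ℝ, E') f x)
    (hy : f x ∈ (extChartAt 𝓘(ℝ, E') y).source) :
    fderiv ℝ (fun w => extChartAt 𝓘(ℝ, E') y (f ((extChartAt 𝓘(ℝ, E) x).symm w)))
        (extChartAt 𝓘(ℝ, E) x x) =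
      (tmap E' E' (extChartAt 𝓘(ℝ, E') y) (f x)).comp (tmap E E' f x) := by
  have hx := extChartAt_to_inv (I := 𝓘(ℝ, E)) x
  rw [tmap_in_charts (mem_extChartAt_target x) (by rwa [hx]) (by rwa [hx]), tmap_symm_self,
    ContinuousLinearMap.comp_id, hx]

end Charts

/-! ### Naturality of the exterior derivative -/

section Naturality

variable {F : Type*} [NormedAddCommGroup F] [NormedSpace ℝ F]
  {S : Type*} [TopologicalSpace S] [ChartedSpace F S] [IsManifold 𝓘(ℝ, F) ∞ S]
  {V : Type*} [NormedAddCommGroup V] [NormedSpace ℝ V]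

/-- A form, with the tangent spaces replaced by the model space. -/
def FormField.plain {F : Type*} [NormedAddCommGroup F] [NormedSpace ℝ F]
    {S : Type*} [TopologicalSpace S] [ChartedSpace F S]
    {V : Type*} [NormedAddCommGroup V] [NormedSpace ℝ V]
    {k : ℕ} (η : FormField F S k V) : S → F [⋀^Fin k]→L[ℝ] V := η

omit [IsManifold 𝓘(ℝ, F) ∞ S] in
theorem inChart_apply {k : ℕ} (η : FormField F S k V) (x : S) (y : F) (v : Fin k → F) :
    inChart η x y v = η.plain ((extChartAt 𝓘(ℝ, F) x).symm y)
      (fun i => tmap F F (extChartAt 𝓘(ℝ, F) x).symm y (v i)) := rfl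

omit [IsManifold 𝓘(ℝ, F) ∞ S] in
theorem IsSmoothForm.differentiableAt {k : ℕ} {η : FormField F S k V} (hη : IsSmoothForm η)
    {x : S} {y : F} (hy : y ∈ (extChartAt 𝓘(ℝ, F) x).target) :
    DifferentiableAt ℝ (inChart η x) y :=
  ((hη x).contDiffAt (extChartAt_target_mem_nhds' hy)).differentiableAt (by simp)

theorem extD_plain_apply {k : ℕ} (η : FormField F S k V) (x : S) (v : Fin (k + 1) → F) :
    (extD η).plain x v = extDeriv (inChart η x) (extChartAt 𝓘(ℝ, F) x x) v := by
  change extDeriv (inChart η x) (extChartAt 𝓘(ℝ, F) x x)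
    (fun i => tmap F F (extChartAt 𝓘(ℝ, F) x) x (v i)) = _
  rw [tmap_chart_self]; rfl

/-- The target chart is left free on purpose: `f = id` yields independence of the chart, and the
chart at `f x` yields naturality under pullback. -/
theorem extD_pullback_in_chart {k : ℕ} {η : FormField F S k V} (hη : IsSmoothForm η) {f : S → S}
    (hf : ContMDiff 𝓘(ℝ, F) 𝓘(ℝ, F) ∞ f) {x y : S} (hx : f x ∈ (extChartAt 𝓘(ℝ, F) y).source)
    (v : Fin (k + 1) → F) :
    (extD (pullback f η)).plain x v =
      extDeriv (inChart η y) (extChartAt 𝓘(ℝ, F) y (f x))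
        (fun i => tmap F F (extChartAt 𝓘(ℝ, F) y) (f x) (tmap F F f x (v i))) := by
  have hx1 : f x ∈ (chartAt F y).source := by rwa [extChartAt_source] at hx
  set ψ := extChartAt 𝓘(ℝ, F) x with hψ
  set χ := extChartAt 𝓘(ℝ, F) y with hχ
  let h : F → F := fun z => χ (f (ψ.symm z))
  have hx0 : ψ.symm (ψ x) = x := extChartAt_to_inv x
  have hcont : ContinuousAt (fun z => f (ψ.symm z)) (ψ x) :=
    hf.continuous.continuousAt.comp (continuousAt_extChartAt_symm x)
  -- Near the centre, the expression of the pullback is the pullback of the expression along `h`, so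
  -- naturality of `extDeriv` on normed spaces applies.
  have hev : inChart (pullback f η) x =ᶠ[𝓝 (ψ x)]
      fun z => (inChart η y (h z)).compContinuousLinearMap (fderiv ℝ h z) := by
    have h1 : ∀ᶠ z in 𝓝 (ψ x), f (ψ.symm z) ∈ χ.source :=
      hcont.eventually ((isOpen_extChartAt_source y).mem_nhds (by simpa only [hx0] using hx))
    filter_upwards [h1, extChartAt_target_mem_nhds (I := 𝓘(ℝ, F)) x] with z hz hz'
    ext w
    have e1 : χ.symm (h z) = f (ψ.symm z) := χ.left_inv hz
    have e2 : fderiv ℝ h z = _ := tmap_in_charts (y := y) hz'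
      (hf.mdifferentiable (by simp) _) hz
    have e3 := tmap_symm_comp_chart hz
    change η.plain (f (ψ.symm z)) (fun i => tmap F F f (ψ.symm z) (tmap F F ψ.symm z (w i))) =
      η.plain (χ.symm (h z)) (fun i => tmap F F χ.symm (h z) (fderiv ℝ h z (w i)))
    rw [e1, e2]
    congr 1
    funext i
    exact (congrArg (fun l => l (tmap F F f (ψ.symm z) (tmap F F ψ.symm z (w i)))) e3).symm
  have hh : ContDiffAt ℝ ∞ h (ψ x) := by
    rw [← contMDiffAt_iff_contDiffAt]
    refine ContMDiffAt.comp (ψ x) (contMDiffAt_extChartAt' ?_)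
      (hf.contMDiffAt.comp _ (contMDiffAt_chart_symm (mem_extChartAt_target x)))
    simpa only [Function.comp_apply, hx0] using hx1
  have hhx : h (ψ x) = χ (f x) := by simp only [h, hx0]
  rw [extD_plain_apply, hev.extDeriv_eq, extDeriv_pullback (r := ∞)
    (by rw [hhx]; exact hη.differentiableAt (χ.map_source hx)) hh (by
      rw [minSmoothness_of_isRCLikeNormedField]; exact WithTop.coe_le_coe.2 le_top)]
  have e4 : fderiv ℝ h (ψ x) = _ := tmap_in_charts_self (x := x) (y := y)
      (hf.mdifferentiable (by simp) _) hx
  rw [e4, hhx]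
  rfl

omit [IsManifold 𝓘(ℝ, F) ∞ S] in
theorem pullback_id {k : ℕ} (η : FormField F S k V) : pullback (fun x => x) η = η := by
  funext x
  ext v
  change η.plain x (fun i => tmap F F (fun x => x) x (v i)) = η.plain x v
  rw [tmap_id]; rfl

/-- The exterior derivative may be computed in any chart. -/
theorem inChart_extD {k : ℕ} {η : FormField F S k V} (hη : IsSmoothForm η) {x : S} {y : F}
    (hy : y ∈ (extChartAt 𝓘(ℝ, F) x).target) :
    inChart (extD η) x y = extDeriv (inChart η x) y := by
  ext v
  have h := extD_pullback_in_chart hη (f := fun x => x) contMDiff_id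
    ((extChartAt 𝓘(ℝ, F) x).map_target hy)
    (fun i => tmap F F (extChartAt 𝓘(ℝ, F) x).symm y (v i))
  rw [pullback_id, (extChartAt 𝓘(ℝ, F) x).right_inv hy, tmap_id] at h
  rw [inChart_apply, h]
  congr 1
  funext i
  exact congrArg (fun l => l (v i)) (tmap_chart_comp_symm hy)

/-- The exterior derivative commutes with pullbacks. -/
theorem extD_pullback {k : ℕ} {η : FormField F S k V} (hη : IsSmoothForm η) {f : S → S}
    (hf : ContMDiff 𝓘(ℝ, F) 𝓘(ℝ, F) ∞ f) : extD (pullback f η) = pullback f (extD η) := by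
  funext x
  ext v
  exact extD_pullback_in_chart hη hf (mem_extChartAt_source (f x)) v

/-- Smoothness of a form can be tested on constant vectors. -/
theorem contDiffOn_alternating [FiniteDimensional ℝ F] [FiniteDimensional ℝ V] {k : ℕ}
    {β : F → F [⋀^Fin k]→L[ℝ] V} {T : Set F}
    (h : ∀ v : Fin k → F, ContDiffOn ℝ ∞ (fun y => β y v) T) : ContDiffOn ℝ ∞ β T := by
  let b := Module.finBasis ℝ F
  let ev : (F [⋀^Fin k]→L[ℝ] V) →ₗ[ℝ] ((Fin k → Fin (Module.finrank ℝ F)) → V) :=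
    { toFun := fun α i => α fun j => b (i j)
      map_add' := fun _ _ => rfl
      map_smul' := fun _ _ => rfl }
  have hev : LinearMap.ker ev = ⊥ := by
    rw [LinearMap.ker_eq_bot]
    intro α α' hαα'
    have : α.toMultilinearMap = α'.toMultilinearMap :=
      Module.Basis.ext_multilinear (fun _ => b) fun i => congrFun hαα' i
    ext v
    exact congrArg (fun m => m v) this
  -- Evaluation on basis vectors is injective, and its algebraic left inverse is continuous since
  -- its source is finite-dimensional. Thus `β` is a continuous linear image of finitely many smooth
  -- functions.
  obtain ⟨l, hl⟩ := ev.exists_leftInverse_of_injective hev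
  have : β = fun y => LinearMap.toContinuousLinearMap l (fun i => β y fun j => b (i j)) := by
    funext y
    exact (congrArg (fun f => f (β y)) hl).symm
  rw [this]
  exact (ContinuousLinearMap.contDiff _).comp_contDiffOn (contDiffOn_pi.2 fun i => h _)

end Naturality

/-! ### Local sections and curves in the fibres of a submersion -/

section Submersion

variable {E : Type*} [NormedAddCommGroup E] [NormedSpace ℝ E]
  {F : Type*} [NormedAddCommGroup F] [NormedSpace ℝ F]
  {M : Type*} [TopologicalSpace M] [ChartedSpace E M]
  {N : Type*} [TopologicalSpace N] [ChartedSpace F N]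

theorem submersion_in_charts {p : M → N} {a : M}
    (h : Manifold.IsSubmersionAt 𝓘(ℝ, E) 𝓘(ℝ, F) ∞ p a) {w : E} (hw : w ∈ h.domChart.target) :
    h.codChart (p (h.domChart.symm w)) = (h.equiv w).1 := by
  have := h.writtenInCharts (show w ∈ (h.domChart.extend 𝓘(ℝ, E)).target by simpa using hw)
  simpa using this

/-- A submersion has smooth local sections. -/
theorem exists_local_section {p : M → N} {a : M}
    (h : Manifold.IsSubmersionAt 𝓘(ℝ, E) 𝓘(ℝ, F) ∞ p a) :
    ∃ σ : N → M, σ (p a) = a ∧ ContMDiffAt 𝓘(ℝ, F) 𝓘(ℝ, E) ∞ σ (p a) ∧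
      ∀ᶠ q in 𝓝 (p a), p (σ q) = q := by
  -- In adapted charts `p` is the first projection; the section keeps the complementary coordinate
  -- equal to that of `a`.
  let τ : N → E := fun q => h.equiv.symm (h.codChart q, (h.equiv (h.domChart a)).2)
  have ha := h.mem_domChart_source
  have hpa := h.mem_codChart_source
  have hτa : τ (p a) = h.domChart a := by
    have := submersion_in_charts h (h.domChart.map_source ha)
    rw [h.domChart.left_inv ha] at this
    simp only [τ, this]
    exact h.equiv.symm_apply_apply _
  have hτ : ContMDiffAt 𝓘(ℝ, F) 𝓘(ℝ, E) ∞ τ (p a) := by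
    have h1 : ContMDiffAt 𝓘(ℝ, F) 𝓘(ℝ, F) ∞ h.codChart (p a) :=
      (contMDiffOn_of_mem_maximalAtlas h.codChart_mem_maximalAtlas).contMDiffAt
        (h.codChart.open_source.mem_nhds hpa)
    have h2 : ContDiff ℝ ∞ fun z : F => h.equiv.symm (z, (h.equiv (h.domChart a)).2) :=
      h.equiv.symm.contDiff.comp (contDiff_id.prodMk contDiff_const)
    exact h2.contMDiff.contMDiffAt.comp (p a) h1
  refine ⟨fun q => h.domChart.symm (τ q), by simp only [hτa, h.domChart.left_inv ha], ?_, ?_⟩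
  · refine ContMDiffAt.comp (p a) ?_ hτ
    refine (contMDiffOn_symm_of_mem_maximalAtlas h.domChart_mem_maximalAtlas).contMDiffAt
      (h.domChart.open_target.mem_nhds ?_)
    rw [hτa]; exact h.domChart.map_source ha
  · have h1 : ∀ᶠ q in 𝓝 (p a), τ q ∈ h.domChart.target :=
      hτ.continuousAt.eventually (h.domChart.open_target.mem_nhds
        (by rw [hτa]; exact h.domChart.map_source ha))
    filter_upwards [h1, h.codChart.open_source.mem_nhds hpa] with q hq hq'
    refine h.codChart.injOn (h.source_subset_preimage_source (h.domChart.map_target hq)) hq' ?_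
    rw [submersion_in_charts h hq]
    simp [τ]

/-- A vector in the kernel of the differential of a submersion is the velocity of a smooth curve
in the fibre. -/
theorem exists_curve_in_fibre {p : M → N} {a : M}
    (h : Manifold.IsSubmersionAt 𝓘(ℝ, E) 𝓘(ℝ, F) ∞ p a) {u : E} (hu : tmap E F p a u = 0) :
    ∃ γ : ℝ → M, ContMDiff 𝓘(ℝ, ℝ) 𝓘(ℝ, E) ∞ γ ∧ γ 0 = a ∧ (∀ t, p (γ t) = p a) ∧
      tmap ℝ E γ 0 1 = u := by
  have ha := h.mem_domChart_source
  have hpa := h.mem_codChart_source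
  have hdc : ContMDiffAt 𝓘(ℝ, E) 𝓘(ℝ, E) ∞ h.domChart a :=
    (contMDiffOn_of_mem_maximalAtlas h.domChart_mem_maximalAtlas).contMDiffAt
      (h.domChart.open_source.mem_nhds ha)
  have hcc : ContMDiffAt 𝓘(ℝ, F) 𝓘(ℝ, F) ∞ h.codChart (p a) :=
    (contMDiffOn_of_mem_maximalAtlas h.codChart_mem_maximalAtlas).contMDiffAt
      (h.codChart.open_source.mem_nhds hpa)
  have hds : ContMDiffOn 𝓘(ℝ, E) 𝓘(ℝ, E) ∞ h.domChart.symm h.domChart.target :=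
    contMDiffOn_symm_of_mem_maximalAtlas h.domChart_mem_maximalAtlas
  set w0 := h.domChart a with hw0
  have hw0t : w0 ∈ h.domChart.target := h.domChart.map_source ha
  set w := tmap E E h.domChart a u with hw
  have hEq : (fun q => h.codChart (p q)) =ᶠ[𝓝 a] fun q => (h.equiv (h.domChart q)).1 := by
    filter_upwards [h.domChart.open_source.mem_nhds ha] with q hq
    have := submersion_in_charts h (h.domChart.map_source hq)
    rwa [h.domChart.left_inv hq] at this
  -- Since `p` is the first projection in the charts, a vertical vector has no component along the
  -- base.
  have hw1 : (h.equiv w).1 = 0 := by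
    have h1 := tmap_congr (E := E) (E' := F) hEq
    rw [tmap_comp a (hcc.mdifferentiableAt (by simp)) (h.contMDiffAt.mdifferentiableAt (by simp)),
      tmap_comp (g := fun z => (h.equiv z).1) (E' := E) a
        (((ContinuousLinearMap.fst ℝ F _).comp
          (h.equiv : E →L[ℝ] F × h.complement)).mdifferentiableAt) (hdc.mdifferentiableAt (by simp)),
      tmap_eq_fderiv] at h1
    have h2 := congrArg (fun l => l u) h1
    have h3 : fderiv ℝ (fun z => (h.equiv z).1) (h.domChart a) =
        (ContinuousLinearMap.fst ℝ F _).comp (h.equiv : E →L[ℝ] F × h.complement) :=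
      ((ContinuousLinearMap.fst ℝ F _).comp (h.equiv : E →L[ℝ] F × h.complement)).fderiv
    rw [h3] at h2
    simpa [hu] using h2.symm
  obtain ⟨ε, hε, hball⟩ := Metric.isOpen_iff.1 h.domChart.open_target w0 hw0t
  set δ := ε / (‖w‖ + 1) with hδ
  have hδ0 : 0 < δ := by positivity
  let c : ℝ → E := fun t => w0 + (δ * Real.sin (t / δ)) • w
  have hc0 : c 0 = w0 := by simp [c]
  have hct : ∀ t, c t ∈ h.domChart.target := by
    intro t
    apply hball
    rw [Metric.mem_ball, dist_eq_norm, add_sub_cancel_left, norm_smul, norm_mul, Real.norm_eq_abs,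
      Real.norm_eq_abs, abs_of_pos hδ0]
    calc δ * |Real.sin (t / δ)| * ‖w‖ ≤ δ * 1 * ‖w‖ := by
          gcongr; exact Real.abs_sin_le_one _
      _ < δ * (‖w‖ + 1) := by nlinarith
      _ = ε := by rw [hδ]; field_simp
  have hc : ContDiff ℝ ∞ c :=
    contDiff_const.add ((contDiff_const.mul (Real.contDiff_sin.comp
      (contDiff_id.div_const δ))).smul contDiff_const)
  have hcd : HasDerivAt c w 0 := by
    have h1 : HasDerivAt (fun t : ℝ => δ * Real.sin (t / δ)) 1 0 := by
      have := (((hasDerivAt_id (0 : ℝ)).div_const δ).sin).const_mul δ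
      simpa [hδ0.ne'] using this
    have h2 := (h1.smul_const w).const_add w0
    rwa [one_smul] at h2
  have hγ : ContMDiff 𝓘(ℝ, ℝ) 𝓘(ℝ, E) ∞ fun t => h.domChart.symm (c t) := fun t =>
    (hds.contMDiffAt (h.domChart.open_target.mem_nhds (hct t))).comp t hc.contMDiff.contMDiffAt
  refine ⟨fun t => h.domChart.symm (c t), hγ, ?_, fun t => ?_, ?_⟩
  · simp only [hc0]; exact h.domChart.left_inv ha
  · refine h.codChart.injOn (h.source_subset_preimage_source (h.domChart.map_target (hct t)))
      hpa ?_
    have h1 : h.codChart (p a) = (h.equiv w0).1 := hEq.self_of_nhds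
    rw [submersion_in_charts h (hct t), h1]
    simp [c, hw1]
  · have hdm := hdc.mdifferentiableAt (n := ∞) (by simp)
    have hsm : MDifferentiableAt 𝓘(ℝ, E) 𝓘(ℝ, E) h.domChart.symm w0 :=
      (hds.contMDiffAt (h.domChart.open_target.mem_nhds hw0t)).mdifferentiableAt (by simp)
    rw [tmap_comp (E' := E) (0 : ℝ) (by rwa [hc0]) hcd.differentiableAt.mdifferentiableAt,
      tmap_eq_fderiv, hc0]
    have h1 : fderiv ℝ c 0 1 = w := hcd.deriv
    rw [ContinuousLinearMap.comp_apply, h1, hw, ← ContinuousLinearMap.comp_apply,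
      ← tmap_comp (g := h.domChart.symm) (f := h.domChart) a hsm hdm]
    have h2 : (fun q => h.domChart.symm (h.domChart q)) =ᶠ[𝓝 a] fun q => q := by
      filter_upwards [h.domChart.open_source.mem_nhds ha] with q hq
      exact h.domChart.left_inv hq
    rw [tmap_congr h2, tmap_id]; rfl

end Submersion

/-! ### Smoothness of the dressing action and the kernel of `ρ_S` -/

section Action

variable {E : Type*} [NormedAddCommGroup E] [NormedSpace ℝ E]
  {F : Type*} [NormedAddCommGroup F] [NormedSpace ℝ F]
  {D : Type*} [TopologicalSpace D] [ChartedSpace E D] [Group D] [LieGroup 𝓘(ℝ, E) ∞ D]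
  {G : Subgroup D} [ChartedSpace F (D ⧸ G)]

/-- The dressing action is smooth. -/
theorem contMDiff_dressing
    (hp : Manifold.IsSubmersion 𝓘(ℝ, E) 𝓘(ℝ, F) ∞ (QuotientGroup.mk : D → D ⧸ G)) :
    ContMDiff (𝓘(ℝ, E).prod 𝓘(ℝ, F)) 𝓘(ℝ, F) ∞ fun q : D × (D ⧸ G) => q.1 • q.2 := by
  rintro ⟨b, x⟩
  obtain ⟨a, rfl⟩ := QuotientGroup.mk_surjective x
  obtain ⟨σ, -, hσ, hσp⟩ := exists_local_section (hp.isSubmersionAt a)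
  -- Through a local section the action becomes multiplication in `D` followed by the projection.
  have h1 : (fun q : D × (D ⧸ G) => q.1 • q.2) =ᶠ[𝓝 (b, (a : D ⧸ G))]
      fun q => QuotientGroup.mk (q.1 * σ q.2) := by
    filter_upwards [continuousAt_snd.eventually hσp] with q hq
    conv_lhs => rw [← hq]
    rfl
  refine ContMDiffAt.congr_of_eventuallyEq ?_ h1
  refine hp.contMDiff.contMDiffAt.comp _ (contMDiffAt_fst.mul ?_)
  exact ContMDiffAt.comp (b, (a : D ⧸ G)) hσ contMDiffAt_snd

theorem contMDiff_dressing_left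
    (hp : Manifold.IsSubmersion 𝓘(ℝ, E) 𝓘(ℝ, F) ∞ (QuotientGroup.mk : D → D ⧸ G)) (a : D) :
    ContMDiff 𝓘(ℝ, F) 𝓘(ℝ, F) ∞ fun x : D ⧸ G => a • x :=
  (contMDiff_dressing hp).comp (contMDiff_const.prodMk contMDiff_id)

theorem contMDiff_dressing_right
    (hp : Manifold.IsSubmersion 𝓘(ℝ, E) 𝓘(ℝ, F) ∞ (QuotientGroup.mk : D → D ⧸ G)) (x : D ⧸ G) :
    ContMDiff 𝓘(ℝ, E) 𝓘(ℝ, F) ∞ fun a : D => a • x :=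
  (contMDiff_dressing hp).comp (contMDiff_id.prodMk contMDiff_const)

omit [LieGroup 𝓘(ℝ, E) ∞ D] in
-- A vertical vector at `1` is the velocity of a curve in the fibre through `1`, and this fibre is
-- `G`.
theorem mem_lieSub_of_tmap_mk_eq_zero
    (hp : Manifold.IsSubmersion 𝓘(ℝ, E) 𝓘(ℝ, F) ∞ (QuotientGroup.mk : D → D ⧸ G)) {u : E}
    (hu : tmap E F (QuotientGroup.mk : D → D ⧸ G) 1 u = 0) : (u : LieAlg E D) ∈ lieSub E G := by
  obtain ⟨γ, hγ, h0, hγp, hd⟩ := exists_curve_in_fibre (hp.isSubmersionAt 1) hu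
  refine Submodule.subset_span ⟨γ, hγ, h0, fun t => ?_, hd⟩
  have := (QuotientGroup.eq.1 (hγp t).symm)
  simpa using this

theorem contMDiff_conj (a : D) : ContMDiff 𝓘(ℝ, E) 𝓘(ℝ, E) ∞ fun b : D => a * b * a⁻¹ :=
  (contMDiff_mul_right (I := 𝓘(ℝ, E)) (n := ∞)).comp contMDiff_mul_left

/-- The kernel of `ρ_S` at `[a]` consists of elements of `Ad_a 𝔤`. -/
theorem Ad_inv_mem_lieSub_of_rho_eq_zero
    (hp : Manifold.IsSubmersion 𝓘(ℝ, E) 𝓘(ℝ, F) ∞ (QuotientGroup.mk : D → D ⧸ G)) (a : D)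
    (u : LieAlg E D) (hu : tmap E F (fun b : D => b • (a : D ⧸ G)) 1 u = 0) :
    Ad a⁻¹ u ∈ lieSub E G := by
  refine mem_lieSub_of_tmap_mk_eq_zero hp (u := Ad a⁻¹ u) ?_
  -- Projecting the conjugate `a⁻¹ b a` is the same as acting by `a⁻¹` on `b • [a]`; hence
  -- `Ad_{a⁻¹}` sends the kernel at `[a]` into the kernel at the base point.
  have hmk : (fun b : D => (QuotientGroup.mk (a⁻¹ * b * a⁻¹⁻¹) : D ⧸ G)) =
      fun b => a⁻¹ • (b • (a : D ⧸ G)) := by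
    funext b
    change _ = (QuotientGroup.mk (a⁻¹ * (b * a)) : D ⧸ G)
    congr 1; group
  have h1 := tmap_comp (g := (QuotientGroup.mk : D → D ⧸ G)) (E'' := F) (1 : D)
    (hp.contMDiff.mdifferentiable (by simp) _)
    ((contMDiff_conj (E := E) a⁻¹).mdifferentiable (by simp) _)
  rw [hmk, tmap_comp (g := fun x : D ⧸ G => a⁻¹ • x) (E' := F) (1 : D)
    ((contMDiff_dressing_left hp a⁻¹).mdifferentiable (by simp) _)
    ((contMDiff_dressing_right hp (a : D ⧸ G)).mdifferentiable (by simp) _)] at h1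
  have h2 (w : E) (hw : tmap E F (fun b : D => b • (a : D ⧸ G)) 1 w = 0) :
      tmap E F (QuotientGroup.mk : D → D ⧸ G) (a⁻¹ * 1 * a⁻¹⁻¹)
        (tmap E E (fun b : D => a⁻¹ * b * a⁻¹⁻¹) 1 w) = 0 := by
    rw [← ContinuousLinearMap.comp_apply, ← h1, ContinuousLinearMap.comp_apply, hw, map_zero]
  have h3 : a⁻¹ * 1 * a⁻¹⁻¹ = 1 := by simp
  rw [h3] at h2
  exact h2 u hu

variable [FiniteDimensional ℝ E]

/-- At `[a]`, applying `Ad_{a⁻¹}` moves both vectors into `𝔤` without changing their pairing, and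
`𝔤` is isotropic. -/
theorem rho_ker_isotropic
    (hp : Manifold.IsSubmersion 𝓘(ℝ, E) 𝓘(ℝ, F) ∞ (QuotientGroup.mk : D → D ⧸ G))
    {n : ℕ} {B : LinearMap.BilinForm ℝ (LieAlg E D)} (hB : IsManinPair G B n) {x : D ⧸ G}
    {u v : LieAlg E D} (hu : tmap E F (fun b : D => b • x) 1 u = 0)
    (hv : tmap E F (fun b : D => b • x) 1 v = 0) : B u v = 0 := by
  obtain ⟨a, rfl⟩ := QuotientGroup.mk_surjective x
  rw [← hB.ad_invariant a⁻¹ u v]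
  exact hB.maximal_isotropic.prop _ (Ad_inv_mem_lieSub_of_rho_eq_zero hp a u hu) _
    (Ad_inv_mem_lieSub_of_rho_eq_zero hp a v hv)

end Action

/-! ### The group and the dressing action in charts -/

section LocalGroup

variable {E : Type*} [NormedAddCommGroup E] [NormedSpace ℝ E]
  {F : Type*} [NormedAddCommGroup F] [NormedSpace ℝ F]
  {D : Type*} [TopologicalSpace D] [ChartedSpace E D] [Group D]
  {G : Subgroup D} [ChartedSpace F (D ⧸ G)]

/-- The multiplication of `D` in the chart at `1`. -/
noncomputable def locMul (E D : Type*) [NormedAddCommGroup E] [NormedSpace ℝ E]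
    [TopologicalSpace D] [ChartedSpace E D] [Group D] (q : E × E) : E :=
  extChartAt 𝓘(ℝ, E) (1 : D) ((extChartAt 𝓘(ℝ, E) (1 : D)).symm q.1 *
    (extChartAt 𝓘(ℝ, E) (1 : D)).symm q.2)

/-- Conjugation in `D` in the chart at `1`. -/
noncomputable def locConj (E D : Type*) [NormedAddCommGroup E] [NormedSpace ℝ E]
    [TopologicalSpace D] [ChartedSpace E D] [Group D] (q : E × E) : E :=
  extChartAt 𝓘(ℝ, E) (1 : D) ((extChartAt 𝓘(ℝ, E) (1 : D)).symm q.1 *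
    (extChartAt 𝓘(ℝ, E) (1 : D)).symm q.2 * ((extChartAt 𝓘(ℝ, E) (1 : D)).symm q.1)⁻¹)

/-- The dressing action in the charts at `1` and `x`. -/
noncomputable def locAct (E F : Type*) [NormedAddCommGroup E] [NormedSpace ℝ E]
    [NormedAddCommGroup F] [NormedSpace ℝ F] {D : Type*}
    [TopologicalSpace D] [ChartedSpace E D] [Group D] {G : Subgroup D} [ChartedSpace F (D ⧸ G)]
    (x : D ⧸ G) (q : E × F) : F :=
  extChartAt 𝓘(ℝ, F) x ((extChartAt 𝓘(ℝ, E) (1 : D)).symm q.1 •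
    (extChartAt 𝓘(ℝ, F) x).symm q.2)

local notation "φ" => extChartAt 𝓘(ℝ, E) (1 : D)

section
variable [LieGroup 𝓘(ℝ, E) ∞ D]

theorem contMDiffAt_symm_fst :
    ContMDiffAt 𝓘(ℝ, E × E) 𝓘(ℝ, E) ∞ (fun q : E × E => (φ).symm q.1) (φ 1, φ 1) :=
  ContMDiffAt.comp (g := (φ).symm) (f := Prod.fst) _
    (contMDiffAt_chart_symm (mem_extChartAt_target _)) contDiff_fst.contMDiff.contMDiffAt

theorem contMDiffAt_symm_snd :
    ContMDiffAt 𝓘(ℝ, E × E) 𝓘(ℝ, E) ∞ (fun q : E × E => (φ).symm q.2) (φ 1, φ 1) :=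
  ContMDiffAt.comp (g := (φ).symm) (f := Prod.snd) _
    (contMDiffAt_chart_symm (mem_extChartAt_target _)) contDiff_snd.contMDiff.contMDiffAt

theorem contDiffAt_locMul : ContDiffAt ℝ 2 (locMul E D) (φ 1, φ 1) := by
  have h : ContMDiffAt 𝓘(ℝ, E × E) 𝓘(ℝ, E) ∞ (locMul E D) (φ 1, φ 1) := by
    refine ContMDiffAt.comp (g := φ) _ (contMDiffAt_extChartAt' ?_)
      (contMDiffAt_symm_fst.mul contMDiffAt_symm_snd)
    simp
  exact h.contDiffAt.of_le (WithTop.coe_le_coe.2 le_top)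

theorem contDiffAt_locConj : ContDiffAt ℝ 2 (locConj E D) (φ 1, φ 1) := by
  have h : ContMDiffAt 𝓘(ℝ, E × E) 𝓘(ℝ, E) ∞ (locConj E D) (φ 1, φ 1) := by
    refine ContMDiffAt.comp (g := φ) _ (contMDiffAt_extChartAt' ?_)
      ((contMDiffAt_symm_fst.mul contMDiffAt_symm_snd).mul contMDiffAt_symm_fst.inv)
    simp
  exact h.contDiffAt.of_le (WithTop.coe_le_coe.2 le_top)

theorem contDiffAt_locAct [IsManifold 𝓘(ℝ, F) ∞ (D ⧸ G)]
    (hp : Manifold.IsSubmersion 𝓘(ℝ, E) 𝓘(ℝ, F) ∞ (QuotientGroup.mk : D → D ⧸ G)) (x : D ⧸ G) :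
    ContDiffAt ℝ 2 (locAct E F x) (φ 1, extChartAt 𝓘(ℝ, F) x x) := by
  have h1 : ContMDiffAt 𝓘(ℝ, E × F) 𝓘(ℝ, E) ∞ (fun q : E × F => (φ).symm q.1)
      (φ 1, extChartAt 𝓘(ℝ, F) x x) :=
    ContMDiffAt.comp (g := (φ).symm) (f := Prod.fst) _
      (contMDiffAt_chart_symm (mem_extChartAt_target _)) contDiff_fst.contMDiff.contMDiffAt
  have h2 : ContMDiffAt 𝓘(ℝ, E × F) 𝓘(ℝ, F) ∞
      (fun q : E × F => (extChartAt 𝓘(ℝ, F) x).symm q.2) (φ 1, extChartAt 𝓘(ℝ, F) x x) :=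
    ContMDiffAt.comp (g := (extChartAt 𝓘(ℝ, F) x).symm) (f := Prod.snd) _
      (contMDiffAt_chart_symm (mem_extChartAt_target _)) contDiff_snd.contMDiff.contMDiffAt
  have h : ContMDiffAt 𝓘(ℝ, E × F) 𝓘(ℝ, F) ∞ (locAct E F x) (φ 1, extChartAt 𝓘(ℝ, F) x x) := by
    refine ContMDiffAt.comp (g := extChartAt 𝓘(ℝ, F) x) _ (contMDiffAt_extChartAt' ?_)
      (ContMDiffAt.comp (g := fun q : D × (D ⧸ G) => q.1 • q.2) _
        (contMDiff_dressing hp).contMDiffAt (h1.prodMk h2))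
    simp
  exact h.contDiffAt.of_le (WithTop.coe_le_coe.2 le_top)

end

theorem chart_symm_one : (φ).symm (φ 1) = 1 := extChartAt_to_inv _

theorem locMul_one_left : ∀ᶠ b in 𝓝 (φ 1), locMul E D (φ 1, b) = b := by
  filter_upwards [extChartAt_target_mem_nhds (I := 𝓘(ℝ, E)) (1 : D)] with b hb
  rw [locMul, chart_symm_one, one_mul, (φ).right_inv hb]

theorem locMul_one_right : ∀ᶠ b in 𝓝 (φ 1), locMul E D (b, φ 1) = b := by
  filter_upwards [extChartAt_target_mem_nhds (I := 𝓘(ℝ, E)) (1 : D)] with b hb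
  rw [locMul, chart_symm_one, mul_one, (φ).right_inv hb]

theorem locConj_one (a : E) : locConj E D (a, φ 1) = φ 1 := by
  rw [locConj, chart_symm_one, mul_one, mul_inv_cancel]

theorem locAct_one (x : D ⧸ G) :
    ∀ᶠ y in 𝓝 (extChartAt 𝓘(ℝ, F) x x), locAct E F x (φ 1, y) = y := by
  filter_upwards [extChartAt_target_mem_nhds (I := 𝓘(ℝ, F)) x] with b hb
  rw [locAct, chart_symm_one, one_smul, (extChartAt 𝓘(ℝ, F) x).right_inv hb]

variable [LieGroup 𝓘(ℝ, E) ∞ D]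

theorem locMul_locConj :
    ∀ᶠ a in 𝓝 (φ 1), ∀ᶠ b in 𝓝 (φ 1), locMul E D (locConj E D (a, b), a) = locMul E D (a, b) := by
  have h : ∀ᶠ q in 𝓝 (φ 1, φ 1),
      (φ).symm q.1 * (φ).symm q.2 * ((φ).symm q.1)⁻¹ ∈ (φ).source := by
    have := ((contMDiffAt_symm_fst (E := E) (D := D)).mul contMDiffAt_symm_snd).mul
      contMDiffAt_symm_fst.inv
    refine this.continuousAt.eventually ((isOpen_extChartAt_source (1 : D)).mem_nhds ?_)
    simp only [Pi.mul_apply, chart_symm_one, mul_one, inv_one]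
    exact mem_extChartAt_source _
  rw [nhds_prod_eq] at h
  filter_upwards [h.curry] with a ha
  filter_upwards [ha] with b hb
  simp only [locMul, locConj, (φ).left_inv hb, inv_mul_cancel_right]

theorem locAct_locMul [IsManifold 𝓘(ℝ, F) ∞ (D ⧸ G)]
    (hp : Manifold.IsSubmersion 𝓘(ℝ, E) 𝓘(ℝ, F) ∞ (QuotientGroup.mk : D → D ⧸ G)) (x : D ⧸ G) :
    ∀ᶠ b in 𝓝 (φ 1), ∀ᶠ a in 𝓝 (φ 1),
      locAct E F x (locMul E D (a, b), extChartAt 𝓘(ℝ, F) x x) =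
        locAct E F x (a, locAct E F x (b, extChartAt 𝓘(ℝ, F) x x)) := by
  -- Here `q = (b, a)`: currying must produce the quantifier over `b` first, whence the reversed
  -- product.
  have h1 : ∀ᶠ q in 𝓝 (φ 1, φ 1), (φ).symm q.2 * (φ).symm q.1 ∈ (φ).source := by
    have := (contMDiffAt_symm_snd (E := E) (D := D)).mul contMDiffAt_symm_fst
    refine this.continuousAt.eventually ((isOpen_extChartAt_source (1 : D)).mem_nhds ?_)
    simp only [Pi.mul_apply, chart_symm_one, mul_one]
    exact mem_extChartAt_source _
  have h2 : ∀ᶠ b in 𝓝 (φ 1), (φ).symm b • x ∈ (extChartAt 𝓘(ℝ, F) x).source := by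
    have : ContinuousAt (fun b => (φ).symm b • x) (φ 1) :=
      (contMDiff_dressing_right hp x).continuous.continuousAt.comp
        (continuousAt_extChartAt_symm (1 : D))
    refine this.eventually ((isOpen_extChartAt_source x).mem_nhds ?_)
    simp only [chart_symm_one, one_smul]
    exact mem_extChartAt_source _
  rw [nhds_prod_eq] at h1
  filter_upwards [h1.curry, h2] with b hb hb'
  filter_upwards [hb] with a ha
  simp only [locAct, locMul, (φ).left_inv ha, extChartAt_to_inv,
    (extChartAt 𝓘(ℝ, F) x).left_inv hb', mul_smul]

/-- The right-invariant fields in the chart at `1`. -/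
theorem generator_locMul (u z : E) (hz : z ∈ (φ).target) :
    generator (locMul E D) (φ 1) u z = tmap E E φ ((φ).symm z)
      (tmap E E (fun b : D => b * (φ).symm z) 1 u) := by
  have h := tmap_in_charts_self (E := E) (E' := E) (M := D) (N := D) (x := 1) (y := 1)
    (f := fun b : D => b * (φ).symm z)
    ((contMDiff_mul_right (I := 𝓘(ℝ, E)) (n := ∞)).mdifferentiable (by simp) 1)
    (by rw [one_mul]; exact (φ).map_target hz)
  rw [one_mul] at h
  exact DFunLike.congr_fun h u

theorem generator_locAct [IsManifold 𝓘(ℝ, F) ∞ (D ⧸ G)]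
    (hp : Manifold.IsSubmersion 𝓘(ℝ, E) 𝓘(ℝ, F) ∞ (QuotientGroup.mk : D → D ⧸ G)) (x : D ⧸ G)
    (u : E) (y : F) (hy : y ∈ (extChartAt 𝓘(ℝ, F) x).target) :
    generator (locAct E F x) (φ 1) u y =
      tmap F F (extChartAt 𝓘(ℝ, F) x) ((extChartAt 𝓘(ℝ, F) x).symm y)
        (tmap E F (fun b : D => b • (extChartAt 𝓘(ℝ, F) x).symm y) 1 u) := by
  have h := tmap_in_charts_self (E := E) (E' := F) (M := D) (N := D ⧸ G) (x := 1) (y := x)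
    (f := fun b : D => b • (extChartAt 𝓘(ℝ, F) x).symm y)
    ((contMDiff_dressing_right hp _).mdifferentiable (by simp) 1)
    (by rw [one_smul]; exact (extChartAt 𝓘(ℝ, F) x).map_target hy)
  rw [one_smul] at h
  exact DFunLike.congr_fun h u

theorem generator_locAct_self [IsManifold 𝓘(ℝ, F) ∞ (D ⧸ G)]
    (hp : Manifold.IsSubmersion 𝓘(ℝ, E) 𝓘(ℝ, F) ∞ (QuotientGroup.mk : D → D ⧸ G)) (x : D ⧸ G)
    (u : E) : generator (locAct E F x) (φ 1) u (extChartAt 𝓘(ℝ, F) x x) =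
      tmap E F (fun b : D => b • x) 1 u := by
  rw [generator_locAct hp x u _ (mem_extChartAt_target x), extChartAt_to_inv, tmap_chart_self]
  rfl

theorem inverse_tmap_symm {z : E} (hz : z ∈ (φ).target) :
    (tmap E E (φ).symm z).inverse = tmap E E φ ((φ).symm z) := by
  refine ContinuousLinearMap.inverse_eq ?_ (tmap_chart_comp_symm hz)
  have := tmap_symm_comp_chart ((φ).map_target hz)
  rwa [(φ).right_inv hz] at this

/-- The manifold bracket is by definition a bracket in the chart, transported back by the derivative
of the chart. At `1` that derivative is the identity, and the right-invariant fields read in the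
chart are the generators of `locMul`. -/
theorem lieFun_eq_lieBracket (u v : E) : (lieFun (E := E) (D := D) u v : E) =
    VectorField.lieBracket ℝ (generator (locMul E D) (φ 1) u)
      (generator (locMul E D) (φ 1) v) (φ 1) := by
  obtain ⟨R, hR⟩ : ∃ R : E → E → E, R = fun w z =>
      (mfderivWithin 𝓘(ℝ, E) 𝓘(ℝ, E) (φ).symm (Set.range 𝓘(ℝ, E)) z : E →L[ℝ] E).inverse
        (rightField (E := E) (D := D) w ((φ).symm z) : E) := ⟨_, rfl⟩
  have h1 (w : E) : R w =ᶠ[𝓝 (φ 1)] generator (locMul E D) (φ 1) w := by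
    filter_upwards [extChartAt_target_mem_nhds (I := 𝓘(ℝ, E)) (1 : D)] with z hz
    rw [generator_locMul w z hz, ← inverse_tmap_symm hz, hR, modelWithCornersSelf_coe,
      Set.range_id, mfderivWithin_univ]
    rfl
  have h2 : (lieFun (E := E) (D := D) u v : E) =
      (tmap E E φ (1 : D)).inverse (VectorField.lieBracketWithin ℝ (R u) (R v)
        ((φ).symm ⁻¹' Set.univ ∩ Set.range 𝓘(ℝ, E)) (φ 1)) := by rw [hR]; rfl
  rw [h2, tmap_chart_self, ContinuousLinearMap.inverse_id, Set.preimage_univ, Set.univ_inter,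
    modelWithCornersSelf_coe, Set.range_id, VectorField.lieBracketWithin_univ,
    (h1 u).lieBracket_vectorField_eq (h1 v), ContinuousLinearMap.id_apply]

end LocalGroup

/-! ### The adjoint action, the bracket and the invariant form -/

section LieAlgebra

variable {E : Type*} [NormedAddCommGroup E] [NormedSpace ℝ E]
  {D : Type*} [TopologicalSpace D] [ChartedSpace E D] [Group D] [LieGroup 𝓘(ℝ, E) ∞ D]

local notation "φ" => extChartAt 𝓘(ℝ, E) (1 : D)

theorem fderiv_conj_in_chart (g : D) (u : E) :
    fderiv ℝ (fun z => φ (g * (φ).symm z * g⁻¹)) (φ 1) u = tmap E E (fun b : D => g * b * g⁻¹) 1 u := by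
  have hg : g * 1 * g⁻¹ = 1 := by simp
  have h := tmap_in_charts_self (E := E) (E' := E) (M := D) (N := D) (x := 1) (y := 1)
    (f := fun b : D => g * b * g⁻¹) ((contMDiff_conj g).mdifferentiable (by simp) 1)
    (by rw [hg]; exact mem_extChartAt_source _)
  rw [hg, tmap_chart_self] at h
  exact DFunLike.congr_fun h u

theorem fderiv_locConj (a u : E) : fderiv ℝ (fun b => locConj E D (a, b)) (φ 1) u =
    tmap E E (fun b : D => (φ).symm a * b * ((φ).symm a)⁻¹) 1 u :=
  fderiv_conj_in_chart ((φ).symm a) u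

/-- The derivative of the adjoint action at the unit. -/
theorem hasFDerivAt_Ad (u : LieAlg E D) : ∃ A : E →L[ℝ] LieAlg E D,
    HasFDerivAt (fun z : E => Ad ((φ).symm z) u) A (φ 1) ∧
      ∀ v : LieAlg E D, A (v : E) = lieFun u v := by
  have key (u : E) : ∃ A : E →L[ℝ] E,
      HasFDerivAt (fun z => tmap E E (fun b : D => (φ).symm z * b * ((φ).symm z)⁻¹) 1 u) A (φ 1) ∧
        ∀ v : E, A v = lieFun (E := E) (D := D) u v := by
    obtain ⟨A, hA, hA'⟩ := hasFDerivAt_conj (contDiffAt_locMul (E := E) (D := D))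
      contDiffAt_locConj locMul_one_left locMul_one_right (Filter.Eventually.of_forall locConj_one)
      locMul_locConj u
    simp only [fderiv_locConj] at hA
    exact ⟨A, hA, fun v => (hA' v).trans (lieFun_eq_lieBracket (E := E) (D := D) u v).symm⟩
  exact key u

/-- The adjoint action of `a`, as a continuous linear map. -/
noncomputable def AdL (a : D) : LieAlg E D →L[ℝ] LieAlg E D :=
  (tmap E E (fun b : D => a * b * a⁻¹) 1 : E →L[ℝ] E)

omit [LieGroup 𝓘(ℝ, E) ∞ D] in
theorem AdL_apply (a : D) (u : LieAlg E D) : AdL a u = Ad a u := rfl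

theorem AdL_mul (a b : D) : (AdL (a * b) : LieAlg E D →L[ℝ] LieAlg E D) = (AdL a).comp (AdL b) := by
  have h : (fun c : D => a * b * c * (a * b)⁻¹) = fun c => a * (b * c * b⁻¹) * a⁻¹ := by
    funext c; group
  have h1 := tmap_comp (g := fun c => a * c * a⁻¹) (E' := E) (E'' := E) (1 : D)
    ((contMDiff_conj a).mdifferentiable (by simp) _)
    ((contMDiff_conj (E := E) b).mdifferentiable (by simp) _)
  have hb : b * 1 * b⁻¹ = 1 := by simp
  rw [← h, hb] at h1
  exact h1

omit [LieGroup 𝓘(ℝ, E) ∞ D] in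
theorem AdL_one : (AdL (1 : D) : LieAlg E D →L[ℝ] LieAlg E D) = ContinuousLinearMap.id ℝ _ := by
  have h : (fun c : D => 1 * c * 1⁻¹) = fun c => c := by funext c; simp
  have h1 := tmap_id (E := E) (1 : D)
  rw [← h] at h1
  exact h1

theorem Ad_mul (a b : D) (u : LieAlg E D) : Ad (a * b) u = Ad a (Ad b u) :=
  DFunLike.congr_fun (AdL_mul a b) u

omit [LieGroup 𝓘(ℝ, E) ∞ D] in
theorem Ad_one (u : LieAlg E D) : Ad (1 : D) u = u :=
  DFunLike.congr_fun AdL_one u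

/-- The identity `Ad_{g z g⁻¹} (Ad_g u) = Ad_g (Ad_z u)` differentiated in `z` at `1` along `v`,
using that the derivative of `z ↦ Ad_z u` is `[u, v]`. -/
theorem lieFun_Ad (g : D) (u v : LieAlg E D) : lieFun (Ad g u) (Ad g v) = Ad g (lieFun u v) := by
  obtain ⟨A, hA, hA'⟩ := hasFDerivAt_Ad (D := D) (Ad g u)
  obtain ⟨A₁, hA₁, hA₁'⟩ := hasFDerivAt_Ad (D := D) u
  let c : E → E := fun z => φ (g * (φ).symm z * g⁻¹)
  have hg : g * 1 * g⁻¹ = 1 := by simp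
  have hce : c (φ 1) = φ 1 := by simp only [c, chart_symm_one, hg]
  have hcont : ContinuousAt (fun z => g * (φ).symm z * g⁻¹) (φ 1) :=
    (contMDiff_conj (E := E) g).continuous.continuousAt.comp (continuousAt_extChartAt_symm (1 : D))
  have hsrc : ∀ᶠ z in 𝓝 (φ 1), g * (φ).symm z * g⁻¹ ∈ (φ).source :=
    hcont.eventually ((isOpen_extChartAt_source (1 : D)).mem_nhds
      (by simp only [chart_symm_one, hg]; exact mem_extChartAt_source _))
  have hc : HasFDerivAt c (tmap E E (fun b : D => g * b * g⁻¹) 1) (φ 1) := by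
    have h1 : ContMDiffAt 𝓘(ℝ, E) 𝓘(ℝ, E) ∞ c (φ 1) := by
      refine ContMDiffAt.comp (φ 1) (contMDiffAt_extChartAt' ?_)
        ((contMDiff_conj (E := E) g).contMDiffAt.comp _
          (contMDiffAt_chart_symm (mem_extChartAt_target _)))
      simp
    have h2 := (h1.contDiffAt.differentiableAt (by simp)).hasFDerivAt
    have h3 : fderiv ℝ c (φ 1) = tmap E E (fun b : D => g * b * g⁻¹) 1 :=
      ContinuousLinearMap.ext fun w => fderiv_conj_in_chart g w
    rwa [h3] at h2
  have hL := (hce.symm ▸ hA : HasFDerivAt (fun z : E => Ad ((φ).symm z) (Ad g u)) A (c (φ 1))).comp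
    (φ 1) hc
  have hR := (AdL g).hasFDerivAt.comp (φ 1) hA₁
  have hev : (fun z => Ad ((φ).symm (c z)) (Ad g u)) =ᶠ[𝓝 (φ 1)]
      fun z => AdL g (Ad ((φ).symm z) u) := by
    filter_upwards [hsrc] with z hz
    simp only [c, (φ).left_inv hz, AdL_apply, ← Ad_mul]
    congr 1; group
  have h := DFunLike.congr_fun ((hR.congr_of_eventuallyEq hev).unique hL) (v : E)
  have h1 : A (Ad g v : E) = AdL g (A₁ (v : E)) := h.symm
  rw [hA', hA₁', AdL_apply] at h1
  exact h1

variable [FiniteDimensional ℝ E]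

theorem lie_apply (u v : LieAlg E D) : lie E D u v = lieFun u v := rfl

theorem lie_skew (u v : LieAlg E D) : lie E D u v = -lie E D v u := by
  have h3 : minSmoothness ℝ 3 ≤ ∞ := by
    rw [minSmoothness_of_isRCLikeNormedField]; exact WithTop.coe_le_coe.2 le_top
  have : LieGroup 𝓘(ℝ, E) (minSmoothness ℝ 3) D := LieGroup.of_le h3
  refine toTangent.injective ?_
  rw [lie_apply, lie_apply, map_neg, lieFun_eq, lieFun_eq, neg_neg, ← _root_.lie_skew, neg_neg]

/-- Passing to the opposite bracket introduces two signs in each double bracket, so the Jacobi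
identity of left-invariant fields carries over. -/
theorem lie_jacobi (u v w : LieAlg E D) :
    lie E D (lie E D u v) w + lie E D (lie E D v w) u + lie E D (lie E D w u) v = 0 := by
  have h3 : minSmoothness ℝ 3 ≤ ∞ := by
    rw [minSmoothness_of_isRCLikeNormedField]; exact WithTop.coe_le_coe.2 le_top
  have : LieGroup 𝓘(ℝ, E) (minSmoothness ℝ 3) D := LieGroup.of_le h3
  refine toTangent.injective ?_
  simp only [lie_apply, map_add, lieFun_eq, map_zero, neg_lie, neg_neg]
  rw [← neg_eq_zero, neg_add, neg_add, _root_.lie_skew, _root_.lie_skew, _root_.lie_skew, add_comm,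
    ← add_assoc]
  exact _root_.lie_jacobi _ _ _

theorem lie_Ad (g : D) (u v : LieAlg E D) : lie E D (Ad g u) (Ad g v) = Ad g (lie E D u v) :=
  lieFun_Ad g u v

/-- Infinitesimal form of the `Ad`-invariance of a bilinear form. -/
theorem form_lie_invariant {B : LinearMap.BilinForm ℝ (LieAlg E D)}
    (hB : ∀ (a : D) (u v : LieAlg E D), B (Ad a u) (Ad a v) = B u v) (u v w : LieAlg E D) :
    B (lie E D u v) w = -B v (lie E D u w) := by
  obtain ⟨A, hA, hA'⟩ := hasFDerivAt_Ad (D := D) v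
  obtain ⟨A₁, hA₁, hA₁'⟩ := hasFDerivAt_Ad (D := D) w
  have h1 : HasFDerivAt (fun z : E => B (Ad ((φ).symm z) v) (Ad ((φ).symm z) w)) _ (φ 1) :=
    (((LinearMap.toContinuousBilinearMap B).hasFDerivAt.comp (φ 1) hA).clm_apply hA₁)
  -- By invariance the function being differentiated is the constant `B v w`, so the product rule
  -- sums to zero.
  simp only [hB] at h1
  have h2 := DFunLike.congr_fun (h1.unique (hasFDerivAt_const _ _)) (u : E)
  have h3 : B v (A₁ (u : E)) + B (A (u : E)) w = 0 := by
    have h4 : B (Ad ((φ).symm (φ 1)) v) (A₁ (u : E)) +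
      B (A (u : E)) (Ad ((φ).symm (φ 1)) w) = 0 := h2
    rwa [chart_symm_one, Ad_one, Ad_one] at h4
  rw [hA', hA₁', ← lie_apply, ← lie_apply, lie_skew w u, lie_skew v u, map_neg, map_neg,
    LinearMap.neg_apply] at h3
  linarith

end LieAlgebra

/-! ### Curvature and Chern–Simons identities -/

section LocalAlgebra

variable {E : Type*} [NormedAddCommGroup E] [NormedSpace ℝ E]
  {F : Type*} [NormedAddCommGroup F] [NormedSpace ℝ F]
  {V : Type*} [NormedAddCommGroup V] [NormedSpace ℝ V]

/-- The generators of a local action, evaluated on the curvature of a splitting, cancel. -/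
theorem generator_curvature {Φ : E × F → F} {e : E} {y : F} {s : F → F →L[ℝ] E}
    (hΦ : ContDiffAt ℝ 2 Φ (e, y)) (hs : DifferentiableAt ℝ s y)
    (h : ∀ᶠ z in 𝓝 y, ∀ X, generator Φ e (s z X) z = X) (X Y : F) :
    generator Φ e (fderiv ℝ s y X Y - fderiv ℝ s y Y X) y +
      VectorField.lieBracket ℝ (generator Φ e (s y X)) (generator Φ e (s y Y)) y = 0 := by
  -- The derivative along `X` of the constant map `z ↦ generator Φ e (s z Y) z = Y`.
  -- Antisymmetrising in `X` and `Y` gives the bracket of the generators with frozen parameters `s y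
  -- X` and `s y Y`.
  have key (X Y : F) : fderiv ℝ (generator Φ e (s y Y)) y X +
      generator Φ e (fderiv ℝ s y X Y) y = 0 := by
    have h1 := (hasFDerivAt_fderiv_right hΦ).clm_apply
      ((hs.hasFDerivAt.clm_apply (hasFDerivAt_const Y y)).prodMk
        (hasFDerivAt_const (0 : F) y))
    have h2 : (fun z => fderiv ℝ Φ (e, z) (s z Y, 0)) =ᶠ[𝓝 y] fun _ => Y := by
      have ht : Filter.Tendsto (fun z : F => (e, z)) (𝓝 y) (𝓝 (e, y)) :=
        (Continuous.prodMk_right e).tendsto y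
      filter_upwards [h, ht.eventually (eventually_differentiableAt hΦ)] with z hz hz'
      rw [← fderiv_partial_left hz']
      exact hz Y
    have h3 := DFunLike.congr_fun
      (h1.unique ((hasFDerivAt_const Y y).congr_of_eventuallyEq h2)) X
    rw [fderiv_generator hΦ, generator_eq hΦ]
    simpa [add_comm] using h3
  have hX := h.self_of_nhds
  rw [VectorField.lieBracket, hX, hX, generator_eq hΦ]
  have h1 := key X Y
  have h2 := key Y X
  rw [generator_eq hΦ] at h1 h2
  have h3 : ((fderiv ℝ s y X Y - fderiv ℝ s y Y X, 0) : E × F) =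
    (fderiv ℝ s y X Y, 0) - (fderiv ℝ s y Y X, 0) := by simp
  rw [h3, map_sub, eq_neg_of_add_eq_zero_left h1, eq_neg_of_add_eq_zero_left h2]
  abel

/-- The Chern–Simons three-form of a one-form `s` with value `a` and derivative `d` at a point. -/
noncomputable def csForm (B : V →L[ℝ] V →L[ℝ] ℝ) (L : V →L[ℝ] V →L[ℝ] V) (a : F →L[ℝ] V)
    (d : F →L[ℝ] F →L[ℝ] V) (X Y Z : F) : ℝ :=
  (1 / 2) * (B (d X Y - d Y X) (a Z) + B (d Y Z - d Z Y) (a X) + B (d Z X - d X Z) (a Y)) +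
    B (L (a X) (a Y)) (a Z)

/-- The curvature of a one-form with value `a` and derivative `d` at a point. -/
noncomputable def curv (L : V →L[ℝ] V →L[ℝ] V) (a : F →L[ℝ] V)
    (d : F →L[ℝ] F →L[ℝ] V) (X Y : F) : V := d X Y - d Y X + L (a X) (a Y)

/-- The derivative of `csForm` along a vector. -/
noncomputable def csFormDeriv (B : V →L[ℝ] V →L[ℝ] ℝ) (L : V →L[ℝ] V →L[ℝ] V) (a : F →L[ℝ] V)
    (d : F →L[ℝ] F →L[ℝ] V) (c : F →L[ℝ] F →L[ℝ] F →L[ℝ] V) (W X Y Z : F) : ℝ :=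
  (1 / 2) * ((B (c W X Y - c W Y X) (a Z) + B (d X Y - d Y X) (d W Z)) +
    (B (c W Y Z - c W Z Y) (a X) + B (d Y Z - d Z Y) (d W X)) +
    (B (c W Z X - c W X Z) (a Y) + B (d Z X - d X Z) (d W Y))) +
    (B (L (d W X) (a Y)) (a Z) + B (L (a X) (d W Y)) (a Z) + B (L (a X) (a Y)) (d W Z))

variable (B : V →L[ℝ] V →L[ℝ] ℝ) (L : V →L[ℝ] V →L[ℝ] V)

theorem fderiv_csForm {s : F → F →L[ℝ] V} {y : F} (hs : ContDiffAt ℝ 2 s y) (W X Y Z : F) :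
    fderiv ℝ (fun z => csForm B L (s z) (fderiv ℝ s z) X Y Z) y W =
      csFormDeriv B L (s y) (fderiv ℝ s y) (fderiv ℝ (fderiv ℝ s) y) W X Y Z := by
  have ha (X : F) : HasFDerivAt (fun z => s z X) ((fderiv ℝ s y).flip X) y := by
    simpa using (hs.differentiableAt (by simp)).hasFDerivAt.clm_apply (hasFDerivAt_const X y)
  have hd (X Y : F) : HasFDerivAt (fun z => fderiv ℝ s z X Y)
      (((fderiv ℝ (fderiv ℝ s) y).flip X).flip Y) y := by
    have h1 : HasFDerivAt (fun z => fderiv ℝ s z X) ((fderiv ℝ (fderiv ℝ s) y).flip X) y := by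
      simpa using (hasFDerivAt_fderiv hs).clm_apply (hasFDerivAt_const X y)
    simpa using h1.clm_apply (hasFDerivAt_const Y y)
  have hB (X Y Z : F) := (B.hasFDerivAt.comp y ((hd X Y).sub (hd Y X))).clm_apply (ha Z)
  have hL := (B.hasFDerivAt.comp y ((L.hasFDerivAt.comp y (ha X)).clm_apply (ha Y))).clm_apply (ha Z)
  have h : HasFDerivAt (fun z => csForm B L (s z) (fderiv ℝ s z) X Y Z) _ y :=
    ((((hB X Y Z).add (hB Y Z X)).add (hB Z X Y)).const_mul (1 / 2)).add hL
  rw [h.fderiv]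
  simp [csFormDeriv]
  ring

variable {B L}

/-- The pointwise form of `d CS(s) = ½⟨F ∧ F⟩`. Second derivatives of `s` cancel by symmetry, and
the terms quartic in `s`, present only on the right, cancel by the Jacobi identity. -/
theorem csForm_closed (hB : ∀ u v, B u v = B v u) (hinv : ∀ u v w, B (L u v) w = B u (L v w))
    (hL : ∀ u v, L u v = -L v u) (hJ : ∀ u v w, L (L u v) w + L (L v w) u + L (L w u) v = 0)
    (a : F →L[ℝ] V) (d : F →L[ℝ] F →L[ℝ] V) (c : F →L[ℝ] F →L[ℝ] F →L[ℝ] V)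
    (hc : ∀ X Y, c X Y = c Y X) (X₀ X₁ X₂ X₃ : F) :
    csFormDeriv B L a d c X₀ X₁ X₂ X₃ - csFormDeriv B L a d c X₁ X₀ X₂ X₃ +
      csFormDeriv B L a d c X₂ X₀ X₁ X₃ - csFormDeriv B L a d c X₃ X₀ X₁ X₂ =
    B (curv L a d X₀ X₁) (curv L a d X₂ X₃) - B (curv L a d X₀ X₂) (curv L a d X₁ X₃) +
      B (curv L a d X₀ X₃) (curv L a d X₁ X₂) := by
  have hJ' := congrArg (fun w => B w (a X₃)) (hJ (a X₀) (a X₁) (a X₂))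
  simp only [map_add, add_apply, map_zero, zero_apply] at hJ'
  rw [hinv (L (a X₀) (a X₁)), hinv (L (a X₁) (a X₂)), hinv (L (a X₂) (a X₀)),
    hL (a X₂) (a X₀), map_neg, neg_apply] at hJ'
  -- Only four kinds of scalar occur: derivative with derivative (`p`), derivative with bracket
  -- (`q`), second derivative with value (`r`), bracket with bracket (`l`). Made opaque, they turn
  -- the identity into a linear one.
  obtain ⟨p, hp⟩ : ∃ p : F → F → F → F → ℝ, ∀ W X Y Z, B (d W X) (d Y Z) = p W X Y Z :=
    ⟨_, fun _ _ _ _ => rfl⟩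
  obtain ⟨q, hq⟩ : ∃ q : F → F → F → F → ℝ, ∀ W X Y Z, B (d W X) (L (a Y) (a Z)) = q W X Y Z :=
    ⟨_, fun _ _ _ _ => rfl⟩
  obtain ⟨r, hr⟩ : ∃ r : F → F → F → F → ℝ, ∀ W X Y Z, B (c W X Y) (a Z) = r W X Y Z :=
    ⟨_, fun _ _ _ _ => rfl⟩
  obtain ⟨l, hl⟩ : ∃ l : F → F → F → F → ℝ, ∀ W X Y Z, B (L (a W) (a X)) (L (a Y) (a Z)) = l W X Y Z :=
    ⟨_, fun _ _ _ _ => rfl⟩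
  have hps (W X Y Z : F) : p W X Y Z = p Y Z W X := by rw [← hp, ← hp, hB]
  have hls (W X Y Z : F) : l W X Y Z = l Y Z W X := by rw [← hl, ← hl, hB]
  have r1 (W X Y Z : F) : B (L (d W X) (a Y)) (a Z) = q W X Y Z := by rw [hinv, hq]
  have r2 (W X Y Z : F) : B (L (a Y) (d W X)) (a Z) = -q W X Y Z := by
    rw [hL, map_neg, neg_apply, r1]
  have r3 (W X Y Z : F) : B (L (a Y) (a Z)) (d W X) = q W X Y Z := by rw [hB, hq]
  simp only [hl] at hJ'
  simp only [csFormDeriv, curv, hc X₁ X₀, hc X₂ X₀, hc X₃ X₀, hc X₂ X₁, hc X₃ X₁, hc X₃ X₂, map_add,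
    map_sub, add_apply, sub_apply, r1, r2, r3, hp, hq, hr, hl]
  -- Of each symmetric pair of `p` terms a single representative is kept.
  rw [hps X₂ X₃ X₀ X₁, hps X₃ X₂ X₀ X₁, hps X₂ X₃ X₁ X₀, hps X₃ X₂ X₁ X₀, hps X₁ X₃ X₀ X₂,
    hps X₃ X₁ X₀ X₂, hps X₁ X₃ X₂ X₀, hps X₃ X₁ X₂ X₀, hps X₁ X₂ X₀ X₃, hps X₂ X₁ X₀ X₃,
    hps X₁ X₂ X₃ X₀, hps X₂ X₁ X₃ X₀]
  linear_combination -hJ' + hls X₁ X₂ X₀ X₃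

end LocalAlgebra

/-! ### Wedge products in low degree -/

section Wedge

variable {F : Type*} [NormedAddCommGroup F] [NormedSpace ℝ F]
  {S : Type*} [TopologicalSpace S] [ChartedSpace F S]
  {V : Type*} [NormedAddCommGroup V] [NormedSpace ℝ V]
  {W : Type*} [NormedAddCommGroup W] [NormedSpace ℝ W]
  {U : Type*} [NormedAddCommGroup U] [NormedSpace ℝ U]

theorem wedge_one_one (B : V →L[ℝ] W →L[ℝ] U) (α : FormField F S 1 V) (β : FormField F S 1 W)
    (x : S) (v : Fin 2 → F) : (wedge B α β).plain x v =
      B (α.plain x ![v 0]) (β.plain x ![v 1]) - B (α.plain x ![v 1]) (β.plain x ![v 0]) := by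
  have huniv : (Finset.univ : Finset (Equiv.Perm (Fin 2))) = {1, Equiv.swap 0 1} := by decide
  have h : (wedge B α β).plain x v = ((Nat.factorial 1 * Nat.factorial 1 : ℝ)⁻¹) •
      ∑ τ : Equiv.Perm (Fin 2), Equiv.Perm.sign τ •
        B (α.plain x fun i => v (τ (Fin.castAdd 1 i))) (β.plain x fun i => v (τ (Fin.natAdd 1 i))) :=
    congrArg (fun z : U => ((Nat.factorial 1 * Nat.factorial 1 : ℝ)⁻¹) • z)
      (ContinuousMultilinearMap.alternatization_apply_apply (tensorMap B (α x) (β x)) v)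
  rw [h, huniv, Finset.sum_insert (by decide), Finset.sum_singleton]
  have e (z : Fin 1 → F) : z = ![z 0] := by ext i; fin_cases i; rfl
  simp only [e fun i : Fin 1 => v _]
  simp [sub_eq_add_neg]

theorem wedge_two_one (B : V →L[ℝ] W →L[ℝ] U) (α : FormField F S 2 V) (β : FormField F S 1 W)
    (x : S) (v : Fin 3 → F) : (wedge B α β).plain x v =
      B (α.plain x ![v 0, v 1]) (β.plain x ![v 2]) + B (α.plain x ![v 1, v 2]) (β.plain x ![v 0]) +
        B (α.plain x ![v 2, v 0]) (β.plain x ![v 1]) := by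
  have huniv : (Finset.univ : Finset (Equiv.Perm (Fin 3))) =
      {1, Equiv.swap 0 1, Equiv.swap 0 2, Equiv.swap 1 2, Equiv.swap 0 1 * Equiv.swap 1 2,
        Equiv.swap 1 2 * Equiv.swap 0 1} := by decide
  have h : (wedge B α β).plain x v = ((Nat.factorial 2 * Nat.factorial 1 : ℝ)⁻¹) •
      ∑ τ : Equiv.Perm (Fin 3), Equiv.Perm.sign τ •
        B (α.plain x fun i => v (τ (Fin.castAdd 1 i))) (β.plain x fun i => v (τ (Fin.natAdd 2 i))) :=
    congrArg (fun z : U => ((Nat.factorial 2 * Nat.factorial 1 : ℝ)⁻¹) • z)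
      (ContinuousMultilinearMap.alternatization_apply_apply (tensorMap B (α x) (β x)) v)
  -- Antisymmetry of `α` pairs the six permutations into three cyclic terms, each counted twice,
  -- which absorbs the factor `1 / 2!`.
  have hα (X Y : F) : α.plain x ![Y, X] = -α.plain x ![X, Y] := by
    have := (α.plain x).toAlternatingMap.map_swap ![X, Y] (i := 0) (j := 1) (by decide)
    rw [← show ![X, Y] ∘ Equiv.swap (0 : Fin 2) 1 = ![Y, X] by
      ext i; fin_cases i <;> simp]
    exact this
  rw [h, huniv]
  repeat rw [Finset.sum_insert (by decide)]
  rw [Finset.sum_singleton]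
  have e (z : Fin 1 → F) : z = ![z 0] := by ext i; fin_cases i; rfl
  have e2 (z : Fin 2 → F) : z = ![z 0, z 1] := by ext i; fin_cases i <;> rfl
  simp only [e fun i : Fin 1 => v _, e2 fun i : Fin 2 => v _]
  have s1 : Equiv.swap (0 : Fin 3) 1 2 = 2 := by decide
  have s2 : Equiv.swap (0 : Fin 3) 2 1 = 1 := by decide
  have s3 : Equiv.swap (1 : Fin 3) 2 0 = 0 := by decide
  simp [hα (v 0) (v 1), hα (v 0) (v 2), hα (v 1) (v 2), s1, s2, s3]
  module

end Wedge

/-! ### One-forms in charts -/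

section OneForms

variable {F : Type*} [NormedAddCommGroup F] [NormedSpace ℝ F]
  {S : Type*} [TopologicalSpace S] [ChartedSpace F S]
  {V : Type*} [NormedAddCommGroup V] [NormedSpace ℝ V]

/-- A one-form, with the tangent spaces replaced by the model space. -/
def plainOne (a : ∀ x : S, TangentSpace 𝓘(ℝ, F) x →L[ℝ] V) : S → F →L[ℝ] V := a

/-- The expression of a one-form in the chart at `x`. -/
noncomputable def locOne (a : ∀ x : S, TangentSpace 𝓘(ℝ, F) x →L[ℝ] V) (x : S) (y : F) :
    F →L[ℝ] V :=
  (plainOne a ((extChartAt 𝓘(ℝ, F) x).symm y)).comp (tmap F F (extChartAt 𝓘(ℝ, F) x).symm y)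

theorem plain_oneForm (a : ∀ x : S, TangentSpace 𝓘(ℝ, F) x →L[ℝ] V) (x : S) (v : Fin 1 → F) :
    (oneForm a).plain x v = plainOne a x (v 0) := rfl

theorem inChart_oneForm (a : ∀ x : S, TangentSpace 𝓘(ℝ, F) x →L[ℝ] V) (x : S) :
    inChart (oneForm a) x = fun y =>
      ContinuousAlternatingMap.ofSubsingletonLIE (𝕜 := ℝ) (E := F) (F := V) (0 : Fin 1)
        (locOne a x y) := rfl

theorem isSmoothForm_oneForm (a : ∀ x : S, TangentSpace 𝓘(ℝ, F) x →L[ℝ] V) :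
    IsSmoothForm (oneForm a) ↔
      ∀ x, ContDiffOn ℝ ∞ (locOne a x) (extChartAt 𝓘(ℝ, F) x).target := by
  refine forall_congr' fun x => ?_
  rw [inChart_oneForm]
  exact ContinuousLinearEquiv.comp_contDiffOn_iff
    (ContinuousAlternatingMap.ofSubsingletonLIE (𝕜 := ℝ) (E := F) (F := V) (0 : Fin 1)
      |>.toContinuousLinearEquiv)

theorem extDeriv_oneForm {a : ∀ x : S, TangentSpace 𝓘(ℝ, F) x →L[ℝ] V} {x : S} {y : F}
    (ha : DifferentiableAt ℝ (locOne a x) y) (v : Fin 2 → F) :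
    extDeriv (inChart (oneForm a) x) y v =
      fderiv ℝ (locOne a x) y (v 0) (v 1) - fderiv ℝ (locOne a x) y (v 1) (v 0) := by
  have h : DifferentiableAt ℝ (inChart (oneForm a) x) y := by
    rw [inChart_oneForm]
    exact (LinearIsometryEquiv.differentiable _).differentiableAt.comp y ha
  have h1 (X Y : F) : fderiv ℝ (fun z => locOne a x z X) y Y = fderiv ℝ (locOne a x) y Y X := by
    have := (ha.hasFDerivAt.clm_apply (hasFDerivAt_const X y)).fderiv
    rw [this]; simp
  rw [extDeriv_apply h, Fin.sum_univ_two]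
  have e0 : (fun z => inChart (oneForm a) x z (Fin.removeNth 0 v)) =
    fun z => locOne a x z (v 1) := rfl
  have e1 : (fun z => inChart (oneForm a) x z (Fin.removeNth 1 v)) =
    fun z => locOne a x z (v 0) := rfl
  rw [e0, e1, h1, h1]
  simp [sub_eq_add_neg]

theorem contDiffOn_csForm {T : Set F} (hT : IsOpen T) {s : F → F →L[ℝ] V}
    (hs : ContDiffOn ℝ ∞ s T) (B : V →L[ℝ] V →L[ℝ] ℝ) (L : V →L[ℝ] V →L[ℝ] V) (X Y Z : F) :
    ContDiffOn ℝ ∞ (fun y => csForm B L (s y) (fderiv ℝ s y) X Y Z) T := by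
  have ha (X : F) : ContDiffOn ℝ ∞ (fun y => s y X) T := hs.clm_apply contDiffOn_const
  have hd (X Y : F) : ContDiffOn ℝ ∞ (fun y => fderiv ℝ s y X Y) T :=
    ((hs.fderiv_of_isOpen hT (m := ∞) (by simp)).clm_apply contDiffOn_const).clm_apply
      contDiffOn_const
  have hB {f g : F → V} (hf : ContDiffOn ℝ ∞ f T) (hg : ContDiffOn ℝ ∞ g T) :
      ContDiffOn ℝ ∞ (fun y => B (f y) (g y)) T := (B.contDiff.comp_contDiffOn hf).clm_apply hg
  have hL (X Y : F) : ContDiffOn ℝ ∞ (fun y => L (s y X) (s y Y)) T :=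
    (L.contDiff.comp_contDiffOn (ha X)).clm_apply (ha Y)
  exact (contDiffOn_const.mul (((hB ((hd X Y).sub (hd Y X)) (ha Z)).add
    (hB ((hd Y Z).sub (hd Z Y)) (ha X))).add (hB ((hd Z X).sub (hd X Z)) (ha Y)))).add
    (hB (hL X Y) (ha Z))

variable [IsManifold 𝓘(ℝ, F) ∞ S]

theorem plainOne_eq_locOne (a : ∀ x : S, TangentSpace 𝓘(ℝ, F) x →L[ℝ] V) {x p : S}
    (hp : p ∈ (extChartAt 𝓘(ℝ, F) x).source) (X : F) :
    locOne a x (extChartAt 𝓘(ℝ, F) x p) (tmap F F (extChartAt 𝓘(ℝ, F) x) p X) =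
      plainOne a p X := by
  have := DFunLike.congr_fun (tmap_symm_comp_chart hp) X
  rw [locOne, (extChartAt 𝓘(ℝ, F) x).left_inv hp, ContinuousLinearMap.comp_apply]
  exact congrArg (plainOne a p) this

theorem locOne_self (a : ∀ x : S, TangentSpace 𝓘(ℝ, F) x →L[ℝ] V) (x : S) :
    locOne a x (extChartAt 𝓘(ℝ, F) x x) = plainOne a x := by
  rw [locOne, extChartAt_to_inv, tmap_symm_self]; rfl

end OneForms

/-! ### The splitting, its curvature and its infinitesimal equivariance -/

section Splitting

variable {E : Type*} [NormedAddCommGroup E] [NormedSpace ℝ E] [FiniteDimensional ℝ E]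
  {F : Type*} [NormedAddCommGroup F] [NormedSpace ℝ F]
  {D : Type*} [TopologicalSpace D] [ChartedSpace E D] [Group D] [LieGroup 𝓘(ℝ, E) ∞ D]
  {G : Subgroup D} [ChartedSpace F (D ⧸ G)] [IsManifold 𝓘(ℝ, F) ∞ (D ⧸ G)]
  {B : LinearMap.BilinForm ℝ (LieAlg E D)}
  {s : ∀ x : D ⧸ G, TangentSpace 𝓘(ℝ, F) x →L[ℝ] LieAlg E D}

local notation "φ" => extChartAt 𝓘(ℝ, E) (1 : D)

omit [IsManifold 𝓘(ℝ, F) ∞ (D ⧸ G)] in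
theorem phi_plain (x : D ⧸ G) (v : Fin 3 → F) : (phi B s).plain x v =
    (1 / 2 : ℝ) * (wedge (LinearMap.toContinuousBilinearMap B) (extD (oneForm s))
      (oneForm s)).plain x v + (1 / 6 : ℝ) * (wedge (LinearMap.toContinuousBilinearMap B)
        (wedge (lie E D) (oneForm s) (oneForm s)) (oneForm s)).plain x v := rfl

omit [IsManifold 𝓘(ℝ, F) ∞ (D ⧸ G)] in
/-- The three-form `phi` at a point, in terms of the exterior derivative of the splitting. -/
theorem phi_apply (hinv : ∀ u v w, B (lie E D u v) w = B u (lie E D v w))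
    (hB : ∀ u v, B u v = B v u) (x : D ⧸ G) (v : Fin 3 → F) : (phi B s).plain x v =
      (1 / 2) * (B ((extD (oneForm s)).plain x ![v 0, v 1]) (plainOne s x (v 2)) +
        B ((extD (oneForm s)).plain x ![v 1, v 2]) (plainOne s x (v 0)) +
        B ((extD (oneForm s)).plain x ![v 2, v 0]) (plainOne s x (v 1))) +
      B (lie E D (plainOne s x (v 0)) (plainOne s x (v 1))) (plainOne s x (v 2)) := by
  rw [phi_plain, wedge_two_one, wedge_two_one]
  simp only [wedge_one_one, plain_oneForm, LinearMap.toContinuousBilinearMap_apply,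
    Matrix.cons_val_zero, Matrix.cons_val_one]
  generalize plainOne s x (v 0) = a
  generalize plainOne s x (v 1) = b
  generalize plainOne s x (v 2) = c
  -- The factor `2` from `[s, s]` and the three equal cyclic terms cancel the coefficient `1 / 6`.
  have h1 (u v w : LieAlg E D) : B (lie E D u v - lie E D v u) w = 2 * B (lie E D u v) w := by
    rw [lie_skew v u, sub_neg_eq_add, ← two_smul ℝ, map_smul, LinearMap.smul_apply, smul_eq_mul]
  have h2 : B (lie E D b c) a = B (lie E D a b) c := by rw [hB, ← hinv]
  have h3 : B (lie E D c a) b = B (lie E D a b) c := by rw [hinv, hB]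
  rw [h1, h1, h1, h2, h3]
  ring

/-- Valid on the whole chart and not only at its centre, so that it gives smoothness of `φ_S` and
can be differentiated to compute `dφ_S`. -/
theorem inChart_phi (hs : IsSmoothForm (oneForm s))
    (hinv : ∀ u v w, B (lie E D u v) w = B u (lie E D v w)) (hB : ∀ u v, B u v = B v u)
    (x : D ⧸ G) {y : F} (hy : y ∈ (extChartAt 𝓘(ℝ, F) x).target) (v : Fin 3 → F) :
    inChart (phi B s) x y v = csForm (LinearMap.toContinuousBilinearMap B) (lie E D)
      (locOne s x y) (fderiv ℝ (locOne s x) y) (v 0) (v 1) (v 2) := by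
  have hd : DifferentiableAt ℝ (locOne s x) y :=
    (((isSmoothForm_oneForm s).1 hs x).contDiffAt
      (extChartAt_target_mem_nhds' hy)).differentiableAt (by simp)
  have h (X Y : F) : (extD (oneForm s)).plain ((extChartAt 𝓘(ℝ, F) x).symm y)
      ![tmap F F (extChartAt 𝓘(ℝ, F) x).symm y X, tmap F F (extChartAt 𝓘(ℝ, F) x).symm y Y] =
      fderiv ℝ (locOne s x) y X Y - fderiv ℝ (locOne s x) y Y X := by
    have h1 : ![tmap F F (extChartAt 𝓘(ℝ, F) x).symm y X,
        tmap F F (extChartAt 𝓘(ℝ, F) x).symm y Y] =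
        fun i => tmap F F (extChartAt 𝓘(ℝ, F) x).symm y (![X, Y] i) := by
      funext i; fin_cases i <;> rfl
    rw [h1, ← inChart_apply, inChart_extD hs hy, extDeriv_oneForm hd]
    rfl
  rw [inChart_apply, phi_apply hinv hB]
  simp only [h]
  rfl

theorem isSmoothForm_phi [FiniteDimensional ℝ F] (hs : IsSmoothForm (oneForm s))
    (hinv : ∀ u v w, B (lie E D u v) w = B u (lie E D v w)) (hB : ∀ u v, B u v = B v u) :
    IsSmoothForm (phi B s) := by
  intro x
  refine contDiffOn_alternating fun v => ?_
  refine (contDiffOn_csForm (isOpen_extChartAt_target x) ((isSmoothForm_oneForm s).1 hs x)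
    (LinearMap.toContinuousBilinearMap B) (lie E D) (v 0) (v 1) (v 2)).congr fun y hy => ?_
  exact inChart_phi hs hinv hB x hy v

omit [LieGroup 𝓘(ℝ, E) ∞ D] [IsManifold 𝓘(ℝ, F) ∞ (D ⧸ G)] in
theorem locOne_sigma (v : LieAlg E D) (x : D ⧸ G) :
    locOne (fun x => ((LinearMap.toContinuousBilinearMap B).flip v).comp (s x)) x =
      fun y => ((LinearMap.toContinuousBilinearMap B).flip v).comp (locOne s x y) := rfl

omit [LieGroup 𝓘(ℝ, E) ∞ D] [IsManifold 𝓘(ℝ, F) ∞ (D ⧸ G)] in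
theorem isSmoothForm_sigma (hs : IsSmoothForm (oneForm s)) (v : lieSub E G) :
    IsSmoothForm (sigma B s v) := by
  refine (isSmoothForm_oneForm _).2 fun x => ?_
  rw [locOne_sigma]
  exact contDiffOn_const.clm_comp ((isSmoothForm_oneForm s).1 hs x)

/-- The infinitesimal dressing action at `x`, as a continuous linear map. -/
noncomputable def rhoL (E F : Type*) [NormedAddCommGroup E] [NormedSpace ℝ E]
    [NormedAddCommGroup F] [NormedSpace ℝ F] {D : Type*}
    [TopologicalSpace D] [ChartedSpace E D] [Group D] {G : Subgroup D} [ChartedSpace F (D ⧸ G)]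
    (x : D ⧸ G) : LieAlg E D →L[ℝ] F := tmap E F (fun b : D => b • x) 1

omit [FiniteDimensional ℝ E] in
-- The condition `ρ_S ∘ s = id` read in the chart, at every point of its target; this is what
-- `generator_curvature` differentiates.
theorem generator_locOne
    (hp : Manifold.IsSubmersion 𝓘(ℝ, E) 𝓘(ℝ, F) ∞ (QuotientGroup.mk : D → D ⧸ G))
    (hs : IsConnectionSplitting B s) (x : D ⧸ G) {y : F}
    (hy : y ∈ (extChartAt 𝓘(ℝ, F) x).target) (X : F) :
    generator (locAct E F x) (φ 1) (locOne s x y X : E) y = X := by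
  have h1 : tmap E F (fun b : D => b • (extChartAt 𝓘(ℝ, F) x).symm y) 1 (locOne s x y X : E) =
      tmap F F (extChartAt 𝓘(ℝ, F) x).symm y X :=
    hs.rho_apply ((extChartAt 𝓘(ℝ, F) x).symm y) (tmap F F (extChartAt 𝓘(ℝ, F) x).symm y X)
  exact (generator_locAct hp x _ y hy).trans ((congrArg _ h1).trans
    (DFunLike.congr_fun (tmap_chart_comp_symm hy) X))

/-- The curvature of a splitting takes values in the kernel of the infinitesimal action. -/
theorem rhoL_curv
    (hp : Manifold.IsSubmersion 𝓘(ℝ, E) 𝓘(ℝ, F) ∞ (QuotientGroup.mk : D → D ⧸ G))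
    (hs : IsConnectionSplitting B s) (x : D ⧸ G) (X Y : F) :
    rhoL E F x (curv (lie E D) (locOne s x (extChartAt 𝓘(ℝ, F) x x))
      (fderiv ℝ (locOne s x) (extChartAt 𝓘(ℝ, F) x x)) X Y) = 0 := by
  have hd : DifferentiableAt ℝ (locOne s x) (extChartAt 𝓘(ℝ, F) x x) :=
    (((isSmoothForm_oneForm s).1 hs.smooth x).contDiffAt
      (extChartAt_target_mem_nhds x)).differentiableAt (by simp)
  -- Replacing `locOne s x` by an `E`-valued copy passes from `LieAlg E D` to the model space, where
  -- the local calculus is stated.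
  have key (s' : F → F →L[ℝ] E) (hs' : s' = locOne s x) :
      tmap E F (fun b : D => b • x) 1 (fderiv ℝ s' (extChartAt 𝓘(ℝ, F) x x) X Y -
        fderiv ℝ s' (extChartAt 𝓘(ℝ, F) x x) Y X) +
      tmap E F (fun b : D => b • x) 1 (lieFun (E := E) (D := D)
        (s' (extChartAt 𝓘(ℝ, F) x x) X) (s' (extChartAt 𝓘(ℝ, F) x x) Y) : E) = 0 := by
    have h1 := generator_curvature (s := s') (contDiffAt_locAct hp x) (by rw [hs']; exact hd)
      (by
        filter_upwards [extChartAt_target_mem_nhds (I := 𝓘(ℝ, F)) x] with y hy X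
        rw [hs']
        exact generator_locOne hp hs x hy X) X Y
    rw [lieBracket_generator contDiffAt_locMul (contDiffAt_locAct hp x) locMul_one_left
      locMul_one_right (locAct_one x).self_of_nhds (locAct_locMul hp x),
      ← lieFun_eq_lieBracket, generator_locAct_self hp] at h1
    have h2 := generator_locAct_self hp x (lieFun (E := E) (D := D)
      (s' (extChartAt 𝓘(ℝ, F) x x) X) (s' (extChartAt 𝓘(ℝ, F) x x) Y) : E)
    exact (congrArg _ h2.symm).trans h1
  have h2 := key (locOne s x) rfl
  rw [curv, map_add]
  exact h2

/-- The infinitesimal form of the equivariance of a splitting. -/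
theorem infinitesimal_equivariance_splitting
    (hp : Manifold.IsSubmersion 𝓘(ℝ, E) 𝓘(ℝ, F) ∞ (QuotientGroup.mk : D → D ⧸ G))
    (hs : IsConnectionSplitting B s) (hse : IsEquivariant s) (x : D ⧸ G) {v : LieAlg E D}
    (hv : v ∈ lieSub E G) (X : F) :
    ∃ X' : F, fderiv ℝ (locOne s x) (extChartAt 𝓘(ℝ, F) x x) (rhoL E F x v) X + plainOne s x X' =
      lie E D (plainOne s x X) v := by
  have hd : DifferentiableAt ℝ (locOne s x) (extChartAt 𝓘(ℝ, F) x x) :=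
    (((isSmoothForm_oneForm s).1 hs.smooth x).contDiffAt
      (extChartAt_target_mem_nhds x)).differentiableAt (by simp)
  -- Only the spanning vectors are velocities of curves in `G`, but the claim is linear in `v`. The
  -- value of `X'` is left unspecified because `s(X')` disappears when paired with `s(Y)`.
  induction hv using Submodule.span_induction with
  | zero => exact ⟨0, by simp⟩
  | add u v _ _ hu hv =>
    obtain ⟨X₁, h₁⟩ := hu
    obtain ⟨X₂, h₂⟩ := hv
    refine ⟨X₁ + X₂, ?_⟩
    rw [map_add, map_add, map_add, map_add, ← h₁, ← h₂, add_apply]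
    abel
  | smul c v _ hv =>
    obtain ⟨X₁, h₁⟩ := hv
    refine ⟨c • X₁, ?_⟩
    rw [map_smul, map_smul, map_smul, map_smul, ← h₁, smul_apply, smul_add]
  | mem v hv =>
    obtain ⟨γ, hγ, h0, hG, hγv⟩ := hv
    have hγv : tmap ℝ E γ 0 1 = v := hγv
    have hφγ : HasDerivAt (fun t => φ (γ t)) (v : E) 0 := by
      have h1 : ContDiffAt ℝ ∞ (fun t => φ (γ t)) 0 := by
        rw [← contMDiffAt_iff_contDiffAt]
        exact ContMDiffAt.comp (0 : ℝ) (contMDiffAt_extChartAt' (by rw [h0]; simp)) (hγ 0)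
      have h2 := (h1.differentiableAt (by simp)).hasDerivAt
      have h3 : deriv (fun t => φ (γ t)) 0 = v := by
        rw [← fderiv_apply_one_eq_deriv, ← tmap_eq_fderiv,
          tmap_comp (g := φ) (E' := E) (0 : ℝ) (mdifferentiableAt_chart (by rw [h0]; simp))
            (hγ.mdifferentiable (by simp) 0), h0, tmap_chart_self]
        exact hγv
      rwa [h3] at h2
    have hsrc : ∀ᶠ t in 𝓝 (0 : ℝ), γ t ∈ (φ).source :=
      hγ.continuous.continuousAt.eventually ((isOpen_extChartAt_source (1 : D)).mem_nhds
        (by rw [h0]; exact mem_extChartAt_source _))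
    have hsrc' : ∀ᶠ t in 𝓝 (0 : ℝ), γ t • x ∈ (extChartAt 𝓘(ℝ, F) x).source := by
      have : ContinuousAt (fun t => γ t • x) 0 :=
        ((contMDiff_dressing_right hp x).continuous.comp hγ.continuous).continuousAt
      refine this.eventually ((isOpen_extChartAt_source x).mem_nhds ?_)
      simp only [h0, one_smul]; exact mem_extChartAt_source _
    obtain ⟨A, hA, hA'⟩ := hasFDerivAt_Ad (D := D) (plainOne s x X)
    have hα : HasDerivAt (fun t => Ad (γ t) (plainOne s x X)) (lie E D (plainOne s x X) v) 0 := by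
      have h1 : HasFDerivAt (fun z : E => Ad ((φ).symm z) (plainOne s x X)) A (φ (γ 0)) := by
        rw [h0]; exact hA
      have h2 := h1.comp_hasDerivAt (0 : ℝ) hφγ
      have h3 : A (v : E) = lie E D (plainOne s x X) v := hA' v
      rw [← h3]
      refine h2.congr_of_eventuallyEq ?_
      filter_upwards [hsrc] with t ht
      exact congrArg (fun b => Ad b (plainOne s x X)) ((φ).left_inv ht).symm
    -- Equivariance under `γ t` is differentiated at `t = 0`; the right side `Ad_{γ t} (s X)`
    -- contributes `[s X, v]`.
    have h := infinitesimal_equivariance (contDiffAt_locAct (E := E) hp x) (locAct_one x) hd hφγ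
      (by rw [h0]) hα X (by
        filter_upwards [hsrc, hsrc'] with t ht ht'
        have h1 := tmap_in_charts_self (E := F) (E' := F) (M := D ⧸ G) (N := D ⧸ G) (x := x)
          (y := x) (f := fun y : D ⧸ G => γ t • y)
          ((contMDiff_dressing_left hp (γ t)).mdifferentiable (by simp) x) ht'
        simp only [locAct, (φ).left_inv ht, extChartAt_to_inv, h1]
        rw [ContinuousLinearMap.comp_apply, plainOne_eq_locOne s ht']
        exact hse ⟨γ t, hG t⟩ x X)
    have hg : generator (locAct E F x) (φ 1) v (extChartAt 𝓘(ℝ, F) x x) = rhoL E F x v :=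
      generator_locAct_self hp x v
    rw [locOne_self, hg] at h
    exact ⟨_, h⟩

end Splitting

/-- Here `R` plays the role of `ρ(v)`. Differentiated isotropy `hd` collapses the six derivative
terms to `⟨d_R s(X), s(Y)⟩ + ⟨ds(X, Y), s(R)⟩`. The latter combines with the cubic term into `⟨F(X,
Y), s(R)⟩ = ⟨F(X, Y), v⟩`, and `hv` turns the former into `-⟨[s X, s Y], v⟩`, leaving `⟨ds(X, Y),
v⟩`. -/
theorem csForm_generator {F : Type*} [NormedAddCommGroup F] [NormedSpace ℝ F]
    {V : Type*} [NormedAddCommGroup V] [NormedSpace ℝ V]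
    {B : V →L[ℝ] V →L[ℝ] ℝ} {L : V →L[ℝ] V →L[ℝ] V} (hB : ∀ u v, B u v = B v u)
    (hinv : ∀ u v w, B (L u v) w = B u (L v w)) (hL : ∀ u v, L u v = -L v u)
    {a : F →L[ℝ] V} {d : F →L[ℝ] F →L[ℝ] V} (hd : ∀ W X Y, B (d W X) (a Y) = -B (d W Y) (a X))
    {R X Y : F} {v : V} (hv : B (d R X) (a Y) = B (L (a X) v) (a Y))
    (hc : B (curv L a d X Y) (a R) = B (curv L a d X Y) v) :
    csForm B L a d R X Y = B (d X Y - d Y X) v := by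
  have h1 : B (L (a R) (a X)) (a Y) = B (L (a X) (a Y)) (a R) := by rw [hinv, hB]
  have h2 : B (L (a X) v) (a Y) = -B (L (a X) (a Y)) v := by
    rw [hL, map_neg, neg_apply, hinv, hB]
  have h3 := hd R X Y
  have h4 := hd X R Y
  have h5 := hd Y R X
  rw [h2] at hv
  simp only [curv, map_add, map_sub, add_apply, sub_apply] at hc
  simp only [csForm, map_sub, sub_apply, h1]
  linarith

/-! ### The zero form and pointwise extensionality -/

section ZeroForms

variable {F : Type*} [NormedAddCommGroup F] [NormedSpace ℝ F]
  {S : Type*} [TopologicalSpace S] [ChartedSpace F S]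
  {V : Type*} [NormedAddCommGroup V] [NormedSpace ℝ V] {k : ℕ}

theorem inChart_zero (x : S) : inChart (0 : FormField F S k V) x = fun _ => 0 := rfl

theorem isSmoothForm_zero : IsSmoothForm (0 : FormField F S k V) := fun x => by
  rw [inChart_zero]; exact contDiffOn_const

theorem extD_zero : extD (0 : FormField F S k V) = 0 := by
  funext x
  ext v
  have h : extDeriv (inChart (0 : FormField F S k V) x) (extChartAt 𝓘(ℝ, F) x x) = 0 := by
    rw [inChart_zero, extDeriv, fderiv_fun_const]
    exact map_zero (ContinuousAlternatingMap.alternatizeUncurryFinCLM ℝ F V)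
  change extDeriv (inChart (0 : FormField F S k V) x) (extChartAt 𝓘(ℝ, F) x x)
    (fun i => tmap F F (extChartAt 𝓘(ℝ, F) x) x (v i)) = 0
  rw [h]; rfl

theorem pullback_plain (f : S → S) (η : FormField F S k V) (x : S) (v : Fin k → F) :
    (pullback f η).plain x v = η.plain (f x) (fun i => tmap F F f x (v i)) := rfl

theorem FormField.ext_plain {η θ : FormField F S k V} (h : ∀ x v, η.plain x v = θ.plain x v) :
    η = θ := by
  funext x
  ext v
  exact h x v

end ZeroForms

/-! ### The components of the Cartan differential and invariance -/

section Cartan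

variable {E : Type*} [NormedAddCommGroup E] [NormedSpace ℝ E] [FiniteDimensional ℝ E]
  {F : Type*} [NormedAddCommGroup F] [NormedSpace ℝ F]
  {D : Type*} [TopologicalSpace D] [ChartedSpace E D] [Group D] [LieGroup 𝓘(ℝ, E) ∞ D]
  {G : Subgroup D} [ChartedSpace F (D ⧸ G)] [IsManifold 𝓘(ℝ, F) ∞ (D ⧸ G)]
  {B : LinearMap.BilinForm ℝ (LieAlg E D)} {n : ℕ}
  {s : ∀ x : D ⧸ G, TangentSpace 𝓘(ℝ, F) x →L[ℝ] LieAlg E D}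

omit [IsManifold 𝓘(ℝ, F) ∞ (D ⧸ G)] in
theorem IsManinPair.form_lie_assoc (hB : IsManinPair G B n) (u v w : LieAlg E D) :
    B (lie E D u v) w = B u (lie E D v w) := by
  rw [lie_skew, map_neg, LinearMap.neg_apply, form_lie_invariant hB.ad_invariant, neg_neg]

omit [FiniteDimensional ℝ E] [LieGroup 𝓘(ℝ, E) ∞ D] [IsManifold 𝓘(ℝ, F) ∞ (D ⧸ G)] in
theorem IsConnectionSplitting.contDiffAt (hs : IsConnectionSplitting B s) (x : D ⧸ G) :
    ContDiffAt ℝ ∞ (locOne s x) (extChartAt 𝓘(ℝ, F) x x) :=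
  ((isSmoothForm_oneForm s).1 hs.smooth x).contDiffAt (extChartAt_target_mem_nhds x)

omit [LieGroup 𝓘(ℝ, E) ∞ D] [IsManifold 𝓘(ℝ, F) ∞ (D ⧸ G)] in
/-- The derivative of the isotropy condition of a splitting. -/
theorem fderiv_isotropic (hB : ∀ u v, B u v = B v u) (hs : IsConnectionSplitting B s)
    (x : D ⧸ G) (W X Y : F) :
    B (fderiv ℝ (locOne s x) (extChartAt 𝓘(ℝ, F) x x) W X)
        (locOne s x (extChartAt 𝓘(ℝ, F) x x) Y) =
      -B (fderiv ℝ (locOne s x) (extChartAt 𝓘(ℝ, F) x x) W Y)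
        (locOne s x (extChartAt 𝓘(ℝ, F) x x) X) := by
  have hd := ((hs.contDiffAt x).differentiableAt (by simp)).hasFDerivAt
  have h1 := ((LinearMap.toContinuousBilinearMap B).hasFDerivAt.comp (extChartAt 𝓘(ℝ, F) x x)
    (hd.clm_apply (hasFDerivAt_const X _))).clm_apply (hd.clm_apply (hasFDerivAt_const Y _))
  -- Isotropy is a pointwise condition on all values of `s`, so this holds for every `y`, even off
  -- the chart target.
  have h2 : (fun y => LinearMap.toContinuousBilinearMap B (locOne s x y X) (locOne s x y Y)) =
      fun _ => 0 := funext fun y => hs.isotropic ((extChartAt 𝓘(ℝ, F) x).symm y)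
        (tmap F F (extChartAt 𝓘(ℝ, F) x).symm y X) (tmap F F (extChartAt 𝓘(ℝ, F) x).symm y Y)
  have h3 : HasFDerivAt
      (fun y => LinearMap.toContinuousBilinearMap B (locOne s x y X) (locOne s x y Y)) _ _ := h1
  rw [h2] at h3
  have h4 := DFunLike.congr_fun (h3.unique (hasFDerivAt_const (0 : ℝ) _)) W
  generalize extChartAt 𝓘(ℝ, F) x x = y at h4 ⊢
  simp at h4
  rw [hB] at h4
  linarith

omit [IsManifold 𝓘(ℝ, F) ∞ (D ⧸ G)] in
-- The vector `w = v - s(ρ(v))` is in the kernel of `ρ_S`, so `⟨w, w⟩ = 0`. As `v` and `s(ρ(v))` are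
-- isotropic too, only the cross term `-2⟨s(ρ(v)), v⟩` remains.
theorem contract_sigma
    (hp : Manifold.IsSubmersion 𝓘(ℝ, E) 𝓘(ℝ, F) ∞ (QuotientGroup.mk : D → D ⧸ G))
    (hB : IsManinPair G B n) (hs : IsConnectionSplitting B s) (v : lieSub E G) :
    contract (rho F (v : LieAlg E D)) (sigma B s v) = 0 := by
  refine FormField.ext_plain fun x w => ?_
  have h1 : rhoL E F x (v - plainOne s x (rhoL E F x v)) = 0 := by
    rw [map_sub, sub_eq_zero]
    exact (hs.rho_apply x (rhoL E F x v)).symm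
  have h2 := rho_ker_isotropic hp hB h1 h1
  have h3 : B (plainOne s x (rhoL E F x v)) (plainOne s x (rhoL E F x v)) = 0 :=
    hs.isotropic x (rhoL E F x v) (rhoL E F x v)
  have h4 := hB.maximal_isotropic.prop v v.2 v v.2
  simp only [map_sub, LinearMap.sub_apply, h3, h4] at h2
  rw [hB.symm v] at h2
  change B (plainOne s x (rhoL E F x v)) v = 0
  linarith

theorem extD_phi [FiniteDimensional ℝ F]
    (hp : Manifold.IsSubmersion 𝓘(ℝ, E) 𝓘(ℝ, F) ∞ (QuotientGroup.mk : D → D ⧸ G))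
    (hB : IsManinPair G B n) (hs : IsConnectionSplitting B s) : extD (phi B s) = 0 := by
  refine FormField.ext_plain fun x v => ?_
  have hφ : IsSmoothForm (phi B s) := isSmoothForm_phi hs.smooth hB.form_lie_assoc hB.symm
  have h2 : ContDiffAt ℝ 2 (locOne s x) (extChartAt 𝓘(ℝ, F) x x) :=
    (hs.contDiffAt x).of_le (WithTop.coe_le_coe.2 le_top)
  have hd (w : Fin 3 → F) (W : F) :
      fderiv ℝ (fun y => inChart (phi B s) x y w) (extChartAt 𝓘(ℝ, F) x x) W =
      csFormDeriv (LinearMap.toContinuousBilinearMap B) (lie E D)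
        (locOne s x (extChartAt 𝓘(ℝ, F) x x)) (fderiv ℝ (locOne s x) (extChartAt 𝓘(ℝ, F) x x))
        (fderiv ℝ (fderiv ℝ (locOne s x)) (extChartAt 𝓘(ℝ, F) x x)) W (w 0) (w 1) (w 2) := by
    have h : (fun y => inChart (phi B s) x y w) =ᶠ[𝓝 (extChartAt 𝓘(ℝ, F) x x)]
        fun y => csForm (LinearMap.toContinuousBilinearMap B) (lie E D)
      (locOne s x y) (fderiv ℝ (locOne s x) y) (w 0) (w 1) (w 2) := by
      filter_upwards [extChartAt_target_mem_nhds (I := 𝓘(ℝ, F)) x] with y hy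
      exact inChart_phi hs.smooth hB.form_lie_assoc hB.symm x hy w
    rw [h.fderiv_eq, fderiv_csForm _ _ h2]
  have hc (X Y : F) : fderiv ℝ (fderiv ℝ (locOne s x)) (extChartAt 𝓘(ℝ, F) x x) X Y =
      fderiv ℝ (fderiv ℝ (locOne s x)) (extChartAt 𝓘(ℝ, F) x x) Y X :=
    (h2.isSymmSndFDerivAt (by simp)).eq X Y
  -- Both curvature values lie in the isotropic kernel of `ρ_S`, so `⟨F ∧ F⟩` vanishes.
  have h0 (W X Y Z : F) : LinearMap.toContinuousBilinearMap B
      (curv (lie E D) (locOne s x (extChartAt 𝓘(ℝ, F) x x))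
        (fderiv ℝ (locOne s x) (extChartAt 𝓘(ℝ, F) x x)) W X)
      (curv (lie E D) (locOne s x (extChartAt 𝓘(ℝ, F) x x))
        (fderiv ℝ (locOne s x) (extChartAt 𝓘(ℝ, F) x x)) Y Z) = 0 :=
    rho_ker_isotropic hp hB (rhoL_curv hp hs x W X) (rhoL_curv hp hs x Y Z)
  have key := csForm_closed (B := LinearMap.toContinuousBilinearMap B) (L := lie E D) hB.symm
    hB.form_lie_assoc lie_skew lie_jacobi (locOne s x (extChartAt 𝓘(ℝ, F) x x))
    (fderiv ℝ (locOne s x) (extChartAt 𝓘(ℝ, F) x x)) _ hc (v 0) (v 1) (v 2) (v 3)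
  rw [h0, h0, h0] at key
  rw [extD_plain_apply, extDeriv_apply (hφ.differentiableAt (mem_extChartAt_target x)),
    Fin.sum_univ_four]
  simp only [hd]
  change _ = (0 : ℝ)
  simp only [Fin.removeNth_apply]
  have a1 : (Fin.succAbove (0 : Fin 4)) 0 = 1 := rfl
  have a2 : (Fin.succAbove (0 : Fin 4)) 1 = 2 := rfl
  have a3 : (Fin.succAbove (0 : Fin 4)) 2 = 3 := rfl
  have b1 : (Fin.succAbove (1 : Fin 4)) 0 = 0 := rfl
  have b2 : (Fin.succAbove (1 : Fin 4)) 1 = 2 := rfl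
  have b3 : (Fin.succAbove (1 : Fin 4)) 2 = 3 := rfl
  have c1 : (Fin.succAbove (2 : Fin 4)) 0 = 0 := rfl
  have c2 : (Fin.succAbove (2 : Fin 4)) 1 = 1 := rfl
  have c3 : (Fin.succAbove (2 : Fin 4)) 2 = 3 := rfl
  have d1 : (Fin.succAbove (3 : Fin 4)) 0 = 0 := rfl
  have d2 : (Fin.succAbove (3 : Fin 4)) 1 = 1 := rfl
  have d3 : (Fin.succAbove (3 : Fin 4)) 2 = 2 := rfl
  rw [a1, a2, a3, b1, b2, b3, c1, c2, c3, d1, d2, d3]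
  generalize extChartAt 𝓘(ℝ, F) x x = y at key ⊢
  simp only [Fin.val_zero, pow_zero, one_smul, Fin.val_one, pow_one, neg_smul, Fin.val_two,
    show ((3 : Fin 4) : ℕ) = 3 from rfl]
  norm_num
  linarith

theorem extD_sigma
    (hp : Manifold.IsSubmersion 𝓘(ℝ, E) 𝓘(ℝ, F) ∞ (QuotientGroup.mk : D → D ⧸ G))
    (hB : IsManinPair G B n) (hs : IsConnectionSplitting B s) (hse : IsEquivariant s)
    (v : lieSub E G) :
    extD (sigma B s v) = contract (rho F (v : LieAlg E D)) (phi B s) := by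
  refine FormField.ext_plain fun x w => ?_
  have hd := (hs.contDiffAt x).differentiableAt (by simp)
  have hd' : HasFDerivAt (fun y => ((LinearMap.toContinuousBilinearMap B).flip
      (v : LieAlg E D)).comp (locOne s x y)) _ (extChartAt 𝓘(ℝ, F) x x) :=
    (hasFDerivAt_const _ _).clm_comp hd.hasFDerivAt
  have h1 (X Y : F) : fderiv ℝ (locOne (fun x => ((LinearMap.toContinuousBilinearMap B).flip
      (v : LieAlg E D)).comp (s x)) x) (extChartAt 𝓘(ℝ, F) x x) X Y =
      B (fderiv ℝ (locOne s x) (extChartAt 𝓘(ℝ, F) x x) X Y) v := by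
    rw [locOne_sigma, hd'.fderiv]
    simp
  have h2 : (extD (sigma B s v)).plain x w =
      B (fderiv ℝ (locOne s x) (extChartAt 𝓘(ℝ, F) x x) (w 0) (w 1) -
        fderiv ℝ (locOne s x) (extChartAt 𝓘(ℝ, F) x x) (w 1) (w 0)) v := by
    rw [extD_plain_apply, sigma, extDeriv_oneForm (by rw [locOne_sigma]; exact hd'.differentiableAt),
      h1, h1, map_sub, LinearMap.sub_apply]
  have h3 : (contract (rho F (v : LieAlg E D)) (phi B s)).plain x w =
      csForm (LinearMap.toContinuousBilinearMap B) (lie E D)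
        (locOne s x (extChartAt 𝓘(ℝ, F) x x)) (fderiv ℝ (locOne s x) (extChartAt 𝓘(ℝ, F) x x))
        (rhoL E F x v) (w 0) (w 1) := by
    have h := inChart_phi hs.smooth hB.form_lie_assoc hB.symm x (mem_extChartAt_target x)
      (Matrix.vecCons (rhoL E F x v) w)
    rw [inChart_apply, tmap_symm_self, extChartAt_to_inv] at h
    exact h
  rw [h2, h3]
  symm
  refine csForm_generator (B := LinearMap.toContinuousBilinearMap B) hB.symm hB.form_lie_assoc
    lie_skew (fderiv_isotropic hB.symm hs x) ?_ ?_
  -- The term `s(X')` of the Lie derivative is killed by isotropy of `s`.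
  · obtain ⟨X', hX'⟩ := infinitesimal_equivariance_splitting hp hs hse x v.2 (w 0)
    have h4 : B (plainOne s x X') (plainOne s x (w 1)) = 0 := hs.isotropic x X' (w 1)
    rw [locOne_self, ← hX', map_add, add_apply]
    exact (add_eq_left.2 h4).symm
  -- The difference `s(ρ(v)) - v` and the curvature both lie in the kernel of `ρ_S`, hence are
  -- orthogonal.
  · have h4 : rhoL E F x (locOne s x (extChartAt 𝓘(ℝ, F) x x) (rhoL E F x v) - v) = 0 := by
      rw [map_sub, sub_eq_zero, locOne_self]
      exact hs.rho_apply x (rhoL E F x v)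
    have h5 := rho_ker_isotropic hp hB (rhoL_curv hp hs x (w 0) (w 1)) h4
    rw [map_sub, sub_eq_zero] at h5
    exact h5

omit [IsManifold 𝓘(ℝ, F) ∞ (D ⧸ G)] in
theorem pullback_sigma (hB : IsManinPair G B n) (hse : IsEquivariant s) (g : G)
    (v : lieSub E G) :
    pullback (fun y : D ⧸ G => (g : D) • y) (sigma B s (adSub G g v)) = sigma B s v := by
  refine FormField.ext_plain fun x w => ?_
  have h := hse g x (w 0)
  change B (s ((g : D) • x) (mfderiv 𝓘(ℝ, F) 𝓘(ℝ, F) (fun y : D ⧸ G => (g : D) • y) x (w 0)))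
    (Ad (g : D) v) = B (s x (w 0)) v
  rw [h, hB.ad_invariant]

omit [FiniteDimensional ℝ E] in
-- Equivariance says `g^* s = Ad_g ∘ s`. The exterior derivative commutes with the pullback on the
-- left and with the constant linear map `Ad_g` on the right.
theorem extD_splitting_equivariant
    (hp : Manifold.IsSubmersion 𝓘(ℝ, E) 𝓘(ℝ, F) ∞ (QuotientGroup.mk : D → D ⧸ G))
    (hs : IsConnectionSplitting B s) (hse : IsEquivariant s) (g : G) (x : D ⧸ G)
    (w : Fin 2 → F) :
    (extD (oneForm s)).plain ((g : D) • x)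
        (fun i => tmap F F (fun y : D ⧸ G => (g : D) • y) x (w i)) =
      Ad (g : D) ((extD (oneForm s)).plain x w) := by
  have hd := (hs.contDiffAt x).differentiableAt (by simp)
  have hd' : HasFDerivAt (fun y => (AdL (g : D)).comp (locOne s x y)) _
      (extChartAt 𝓘(ℝ, F) x x) :=
    (hasFDerivAt_const _ _).clm_comp hd.hasFDerivAt
  have h0 : locOne (fun x => (AdL (g : D)).comp (s x)) x =
    fun y => (AdL (g : D)).comp (locOne s x y) := rfl
  have h1 : pullback (fun y : D ⧸ G => (g : D) • y) (oneForm s) =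
      oneForm fun x => (AdL (g : D)).comp (s x) :=
    FormField.ext_plain fun x w => hse g x (w 0)
  rw [← pullback_plain, ← extD_pullback hs.smooth (contMDiff_dressing_left hp (g : D)), h1,
    extD_plain_apply, extD_plain_apply, extDeriv_oneForm hd,
    extDeriv_oneForm (by rw [h0]; exact hd'.differentiableAt), h0, hd'.fderiv, ← AdL_apply, map_sub]
  simp

theorem pullback_phi
    (hp : Manifold.IsSubmersion 𝓘(ℝ, E) 𝓘(ℝ, F) ∞ (QuotientGroup.mk : D → D ⧸ G))
    (hB : IsManinPair G B n) (hs : IsConnectionSplitting B s) (hse : IsEquivariant s) (g : G) :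
    pullback (fun y : D ⧸ G => (g : D) • y) (phi B s) = phi B s := by
  refine FormField.ext_plain fun x w => ?_
  have h1 (X : F) : plainOne s ((g : D) • x) (tmap F F (fun y : D ⧸ G => (g : D) • y) x X) =
    Ad (g : D) (plainOne s x X) := hse g x X
  have h2 (X Y : F) : (extD (oneForm s)).plain ((g : D) • x)
      ![tmap F F (fun y : D ⧸ G => (g : D) • y) x X,
        tmap F F (fun y : D ⧸ G => (g : D) • y) x Y] =
      Ad (g : D) ((extD (oneForm s)).plain x ![X, Y]) := by
    rw [← extD_splitting_equivariant hp hs hse]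
    congr 1
    funext i
    fin_cases i <;> rfl
  rw [pullback_plain, phi_apply hB.form_lie_assoc hB.symm, phi_apply hB.form_lie_assoc hB.symm]
  simp only [h1, h2, lie_Ad, hB.ad_invariant]

variable (F) in
/-- `sigma` as a linear map. -/
noncomputable def sigmaLinear (B : LinearMap.BilinForm ℝ (LieAlg E D))
    (s : ∀ x : D ⧸ G, TangentSpace 𝓘(ℝ, F) x →L[ℝ] LieAlg E D) :
    lieSub E G →ₗ[ℝ] FormField F (D ⧸ G) 1 ℝ where
  toFun v := sigma B s v
  map_add' u v := FormField.ext_plain fun x w => map_add (B (plainOne s x (w 0))) u.1 v.1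
  map_smul' c v := FormField.ext_plain fun x w => map_smul (B (plainOne s x (w 0))) c v.1

theorem isCartanCochain_sigmaPlusPhi [FiniteDimensional ℝ F]
    (hp : Manifold.IsSubmersion 𝓘(ℝ, E) 𝓘(ℝ, F) ∞ (QuotientGroup.mk : D → D ⧸ G))
    (hB : IsManinPair G B n) (hs : IsConnectionSplitting B s) (hse : IsEquivariant s) :
    IsCartanCochain 3 (sigmaPlusPhi B s) where
  homogeneous i j hij := by
    obtain ⟨rfl, rfl⟩ | ⟨rfl, rfl⟩ : i = 1 ∧ j = 1 ∨ i = 0 ∧ j = 3 := by omega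
    · exact ⟨MultilinearMap.ofSubsingleton ℝ _ _ 0 (sigmaLinear F B s), fun v => rfl⟩
    · exact ⟨MultilinearMap.constOfIsEmpty ℝ _ (phi B s), fun v => rfl⟩
  eq_zero j hj v := by
    match j with
    | 0 | 2 | _ + 4 => rfl
    | 1 => exact absurd rfl (hj 1)
    | 3 => exact absurd rfl (hj 0)
  smooth v j := by
    match j with
    | 0 | 2 | _ + 4 => exact isSmoothForm_zero
    | 1 => exact isSmoothForm_sigma hs.smooth v
    | 3 => exact isSmoothForm_phi hs.smooth hB.form_lie_assoc hB.symm
  invariant g v j := by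
    match j with
    | 0 | 2 | _ + 4 => rfl
    | 1 => exact pullback_sigma hB hse g v
    | 3 => exact pullback_phi hp hB hs hse g

theorem cartanD_sigmaPlusPhi [FiniteDimensional ℝ F]
    (hp : Manifold.IsSubmersion 𝓘(ℝ, E) 𝓘(ℝ, F) ∞ (QuotientGroup.mk : D → D ⧸ G))
    (hB : IsManinPair G B n) (hs : IsConnectionSplitting B s) (hse : IsEquivariant s) :
    cartanD (sigmaPlusPhi B s) = 0 := by
  funext v j
  -- The nontrivial components are `i_{ρ(v)} σ(v) = 0` in degree `0`, `dσ(v) = i_{ρ(v)} φ_S` in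
  -- degree `2` and `dφ_S = 0` in degree `4`; in the other degrees both terms come from zero forms.
  match j with
  | 0 => exact neg_eq_zero.2 (contract_sigma hp hB hs v)
  | 1 | 3 | _ + 5 => exact sub_eq_zero.2 extD_zero
  | 2 => exact sub_eq_zero.2 (extD_sigma hp hB hs hse v)
  | 4 => exact sub_eq_zero.2 (extD_phi hp hB hs)

end Cartan

end GroupPair

/-- `S = D ⧸ G` carries its quotient manifold structure, which is the (unique) smooth structure on
the quotient space for which the projection `D → D ⧸ G` is a submersion. -/
theorem proposition3p9
    {E : Type*} [NormedAddCommGroup E] [NormedSpace ℝ E] [FiniteDimensional ℝ E]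
    {F : Type*} [NormedAddCommGroup F] [NormedSpace ℝ F] [FiniteDimensional ℝ F]
    {D : Type*} [TopologicalSpace D] [ChartedSpace E D] [Group D] [LieGroup 𝓘(ℝ, E) ∞ D]
    [T2Space D] [ConnectedSpace D]
    (G : Subgroup D) (hG_closed : IsClosed (G : Set D)) (hG_conn : IsConnected (G : Set D))
    [ChartedSpace F (D ⧸ G)] [IsManifold 𝓘(ℝ, F) ∞ (D ⧸ G)]
    (hp : Manifold.IsSubmersion 𝓘(ℝ, E) 𝓘(ℝ, F) ∞ (QuotientGroup.mk : D → D ⧸ G))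
    (n : ℕ) (B : LinearMap.BilinForm ℝ (GroupPair.LieAlg E D)) (hB : GroupPair.IsManinPair G B n)
    (s : ∀ x : D ⧸ G, TangentSpace 𝓘(ℝ, F) x →L[ℝ] GroupPair.LieAlg E D)
    (hs : GroupPair.IsConnectionSplitting B s) (hs_equiv : GroupPair.IsEquivariant s) :
    GroupPair.IsCartanCochain 3 (GroupPair.sigmaPlusPhi B s) ∧ GroupPair.cartanD (GroupPair.sigmaPlusPhi B s) = 0 := by
  exact ⟨GroupPair.isCartanCochain_sigmaPlusPhi hp hB hs hs_equiv,
    GroupPair.cartanD_sigmaPlusPhi hp hB hs hs_equiv⟩
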